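/- **Proposition (On-diagonal upper bound for the Dirichlet heat kernel).** Let $G=(V,E_V)$ be a locally finite, connected, infinite graph with graph distance $\rho$, fix a vertex $0\in V$, and write $B(x,r)=\{y\in V:\rho(y,x)\le r\}$. Let $d>0$ and $\alpha\in(0,2)$. Let $\mu$ be a measure on $V$ with weights $\mu_x=\mu(\{x\})$, and let $w_{x,y}=w_{y,x}\ge 0$ $(x,y\in V)$ satisfy $w_{x,x}=0$ and $\sum_{y\ne x} w_{x,y}\mu_y\,\rho(x,y)^{-d-\alpha}<\infty$ for all $x\in V$. Consider $$D(f,f)=\frac12\sum_{x,y\in V}(f(x)-f(y))^2\frac{w_{x,y}}{\rho(x,y)^{d+\alpha}}\mu_x\mu_y,\qquad \mathscr F=\{f\in L^2(V;\mu): D(f,f)<\infty\}.$$ For a finite set $A\subset V$, let $p^A(t,x,y)$ be the Dirichlet heat kernel of $A$, i.e. the kernel with respect to $\mu$ of the semigroup of the form $(D,\mathscr F)$ restricted to functions vanishing off $A$; if $X$ is a symmetric Hunt process associated with $(D,\mathscr F)$ and $\tau_A=\inf\{t>0:X_t\notin A\}$, this is the transition density $\mathbb P_x(X_t=y,\ t<\tau_A)/\mu_y$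 of $X$ killed on exiting $A$. Put $B^w_z(x,r)=\{y\in B(x,r): w_{y,z}>0\}$ and $B^w(x,r)=B^w_x(x,r)$. Assume the following, where $\kappa>0$, $c_\mu\ge1$, $\theta\in(0,1)$, $c_0>1/2$, $C_0>0$ and $R_0,R_0'\ge1$. 1. (d-Vol) $0<\mu_x\le c_\mu$ for all $x\in V$; $\inf_{x\in B(0,R)}\mu_x\ge R^{-\kappa}$ for all $R\ge R_0$; and $c_\mu^{-1}r^d\le\mu(B(x,r))\le c_\mu r^d$ for all $R\ge R_0$, $x\in B(0,6R)$ and $R^\theta/2\le r\le 2R$. 2. For all $R\ge R_0'$ and $R^\theta\le r\le R$, $$\mu(B^w_z(x,r))\ge c_0\,\mu(B(x,r))\quad\text{for all } x,z\in B(0,2R),\qquad \sup_{x\in B(0,2R)}\ \sum_{y\in B^w(x,2r)}w_{x,y}^{-1}\mu_y\le C_0r^d .$$ Then for every $\theta'\in(\theta,1)$ there is a constant $R_1\ge1$ such that for all $R>R_1$, all $x_1,x_2\in B(0,R)$ and all $t\ge R^{\theta'\alpha}$, $$p^{B(0,R)}(t,x_1,x_2)\le C_1t^{-d/\alpha},$$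 where $C_1>0$ depends only on $d,\alpha,c_\mu,\kappa,\theta,c_0,C_0,\theta'$; in particular it is independent of $R_0,R_0',R_1,R,x_1,x_2$ and $t$. -/

import Mathlib

open Filter Topology MeasureTheory
open scoped NNReal ENNReal

namespace Conductance

variable {V : Type*}

/-- The closed ball `B(x, r) = {y : ρ(y, x) ≤ r}` for the graph distance `ρ`. -/
def ball (G : SimpleGraph V) (x : V) (r : ℝ) : Set V :=
  {y | (G.dist y x : ℝ) ≤ r}

/-- The ball `B_z^w(x, r) = {y ∈ B(x, r) : w_{y,z} > 0}`. -/
def wball (G : SimpleGraph V) (w : V → V → ℝ) (z x : V) (r : ℝ) : Set V :=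
  {y | y ∈ ball G x r ∧ 0 < w y z}

/-- The measure `μ(A) = ∑_{x ∈ A} μ_x` of a finite set `A` (all balls of a connected, locally finite
graph are finite, see `ball_finite`). -/
noncomputable def vol (μ : V → ℝ) (A : Set V) : ℝ :=
  ∑ᶠ x ∈ A, μ x

theorem ball_finite (G : SimpleGraph V) (hconn : G.Connected)
    (hfin : ∀ x, (G.neighborSet x).Finite) (x : V) (r : ℝ) : (ball G x r).Finite := by
  have key : ∀ n : ℕ, {y | G.dist y x ≤ n}.Finite := by
    intro n
    induction n with
    | zero =>
      refine (Set.finite_singleton x).subset ?_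
      intro y hy
      have h0 : G.dist y x = 0 := Nat.le_zero.mp hy
      exact (hconn.dist_eq_zero_iff).mp h0
    | succ n ih =>
      refine (ih.union (ih.biUnion fun z _ => hfin z)).subset ?_
      intro y hy
      by_cases hle : G.dist y x ≤ n
      · exact Or.inl hle
      · right
        have hy1 : G.dist y x ≤ n + 1 := hy
        have hy' : G.dist y x = n + 1 := by omega
        obtain ⟨p, hp⟩ := hconn.exists_walk_length_eq_dist y x
        cases p with
        | nil =>
          rw [← hp] at hy'
          simp at hy'
        | cons h q =>
          rename_i z
          refine Set.mem_biUnion (x := z) ?_ ?_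
          · have h1 := SimpleGraph.dist_le q
            simp only [SimpleGraph.Walk.length_cons] at hp
            show G.dist z x ≤ n
            omega
          · exact h.symm
  refine (key ⌊r⌋₊).subset ?_
  intro y hy
  exact Nat.le_floor hy

/-- Assumption (d-Vol), with constants `d`, `κ`, `cμ`, `θ` and threshold `R₀`. -/
structure DVol (G : SimpleGraph V) (μ : V → ℝ) (o : V) (d κ cμ θ R₀ : ℝ) : Prop where
  pos : ∀ x, 0 < μ x
  le : ∀ x, μ x ≤ cμ
  lower : ∀ R : ℝ, R₀ ≤ R → ∀ x ∈ ball G o R, R ^ (-κ) ≤ μ x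
  volume : ∀ R : ℝ, R₀ ≤ R → ∀ x ∈ ball G o (6 * R), ∀ r : ℝ, R ^ θ / 2 ≤ r → r ≤ 2 * R →
    cμ⁻¹ * r ^ d ≤ vol μ (ball G x r) ∧ vol μ (ball G x r) ≤ cμ * r ^ d

/-- The jump kernel `w_{x,y} / ρ(x,y)^{d+α}` (it vanishes on the diagonal, as `w_{x,x} = 0`). -/
noncomputable def jump (G : SimpleGraph V) (w : V → V → ℝ) (d α : ℝ) (x y : V) : ℝ :=
  w x y / (G.dist x y : ℝ) ^ (d + α)

/-- The standing hypotheses on `w`: nonnegative, symmetric, zero on the diagonal, and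
`∑_{y ≠ x} w_{x,y} μ_y / ρ(x,y)^{d+α} < ∞` for every `x`. -/
structure IsConductance (G : SimpleGraph V) (μ : V → ℝ) (w : V → V → ℝ) (d α : ℝ) : Prop where
  nonneg : ∀ x y, 0 ≤ w x y
  symm : ∀ x y, w x y = w y x
  diag : ∀ x, w x x = 0
  summable : ∀ x, Summable fun y => jump G w d α x y * μ y

/-- The summand of the Dirichlet form. -/
noncomputable def energyDensity (G : SimpleGraph V) (μ : V → ℝ) (w : V → V → ℝ) (d α : ℝ)
    (f : V → ℝ) (p : V × V) : ℝ :=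
  (f p.1 - f p.2) ^ 2 * jump G w d α p.1 p.2 * μ p.1 * μ p.2

/-- The Dirichlet form
`D(f,f) = ½ ∑_{x,y} (f(x) - f(y))² w_{x,y} ρ(x,y)^{-(d+α)} μ_x μ_y`. -/
noncomputable def energy (G : SimpleGraph V) (μ : V → ℝ) (w : V → V → ℝ) (d α : ℝ)
    (f : V → ℝ) : ℝ :=
  1 / 2 * ∑' p : V × V, energyDensity G μ w d α f p

/-- Membership in `L²(V; μ)`. -/
def MemL2 (μ : V → ℝ) (f : V → ℝ) : Prop :=
  Summable fun x => f x ^ 2 * μ x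

/-- Membership in the domain `{f ∈ L²(V; μ) : D(f,f) < ∞}` of the Dirichlet form. -/
def MemDomain (G : SimpleGraph V) (μ : V → ℝ) (w : V → V → ℝ) (d α : ℝ) (f : V → ℝ) : Prop :=
  MemL2 μ f ∧ Summable (energyDensity G μ w d α f)

/-- The generator `L f(x) = ∑_z (f(z) - f(x)) w_{x,z} μ_z / ρ(x,z)^{d+α}`. -/
noncomputable def generator (G : SimpleGraph V) (μ : V → ℝ) (w : V → V → ℝ) (d α : ℝ)
    (f : V → ℝ) (x : V) : ℝ :=
  ∑' z, (f z - f x) * (jump G w d α x z * μ z)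

open Classical in
/-- The matrix of the generator `L` with zero exterior condition off `A`, that is, of
`f ↦ (L f)|_A` on the functions `f` that vanish off `A`. -/
noncomputable def dirichletGenerator (G : SimpleGraph V) (μ : V → ℝ) (w : V → V → ℝ) (d α : ℝ)
    (A : Set V) : Matrix A A ℝ :=
  Matrix.of fun x y => generator G μ w d α (Pi.single (y : V) 1) (x : V)

open Classical in
/-- The heat kernel, with respect to `μ`, of the Dirichlet form `(D, F)` restricted to the functions
vanishing off a finite set `A`: the operator `f ↦ ∑_y p^A(t, ·, y) f(y) μ_y` is the semigroup
`exp (t L^A)` of this form, and `p^A(t, x, y) = 0` unless `x, y ∈ A`.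
(For infinite `A`, which is not used, the value is `0`.) -/
noncomputable def dirichletHeatKernel (G : SimpleGraph V) (μ : V → ℝ) (w : V → V → ℝ) (d α : ℝ)
    (A : Set V) (t : ℝ) (x y : V) : ℝ :=
  if h : A.Finite ∧ x ∈ A ∧ y ∈ A then
    letI : Fintype A := h.1.fintype
    NormedSpace.exp (t • dirichletGenerator G μ w d α A) ⟨x, h.2.1⟩ ⟨y, h.2.2⟩ / μ y
  else 0

/-- A right-continuous time-homogeneous (simple) Markov process on the discrete space `V` with
cemetery `∂ = none`, on a sample space `Ω` with laws `P x`, `x ∈ V`. Every Hunt process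
on `V` is such a process. -/
structure MarkovProcess (V : Type*) (Ω : Type*) [MeasurableSpace Ω] where
  /-- the position at time `t`; `none` is the cemetery -/
  X : ℝ≥0 → Ω → Option V
  /-- the law of the process started at `x` -/
  P : V → Measure Ω
  isProbabilityMeasure : ∀ x, IsProbabilityMeasure (P x)
  measurable : ∀ t, Measurable[_, ⊤] (X t)
  start : ∀ x, ∀ᵐ ω ∂(P x), X 0 ω = some x
  rightContinuous : ∀ ω t v, X t ω = some v →
    ∃ ε : ℝ≥0, 0 < ε ∧ ∀ s, t ≤ s → s < t + ε → X s ω = some v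
  absorbed : ∀ ω s t, s ≤ t → X s ω = none → X t ω = none
  markov : ∀ (x : V) (s t : ℝ≥0) (E : Set Ω),
    MeasurableSet[⨆ u : Set.Iic s, MeasurableSpace.comap (X u) ⊤] E → ∀ z y : V,
    P x (E ∩ {ω | X s ω = some z} ∩ {ω | X (s + t) ω = some y}) =
      P x (E ∩ {ω | X s ω = some z}) * P z {ω | X t ω = some y}

namespace MarkovProcess

variable {Ω : Type*} [MeasurableSpace Ω]

/-- The transition function `P_x(X_t = y)`. -/
noncomputable def trans (M : MarkovProcess V Ω) (t : ℝ≥0) (x y : V) : ℝ :=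
  (M.P x).real {ω | M.X t ω = some y}

/-- The semigroup `P_t f(x) = E_x[f(X_t)]`, where `f(∂) = 0`. -/
noncomputable def semigroup (M : MarkovProcess V Ω) (t : ℝ≥0) (f : V → ℝ) (x : V) : ℝ :=
  ∑' y, M.trans t x y * f y

/-- The approximating form `(1/t) ⟨f - P_t f, f⟩_{L²(μ)}`. -/
noncomputable def approxForm (M : MarkovProcess V Ω) (μ : V → ℝ) (f : V → ℝ) (t : ℝ≥0) : ℝ :=
  (t : ℝ)⁻¹ * ∑' x, (f x - M.semigroup t f x) * f x * μ x

/-- The process is `μ`-symmetric and its Dirichlet form is `(D, F)`: for `f ∈ L²(V; μ)`, the limit of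
`(1/t) ⟨f - P_t f, f⟩` as `t ↓ 0` exists in `ℝ` if and only if `f ∈ F`, and then it is `D(f,f)`. -/
structure IsAssociated (M : MarkovProcess V Ω) (G : SimpleGraph V) (μ : V → ℝ) (w : V → V → ℝ)
    (d α : ℝ) : Prop where
  symm : ∀ t x y, μ x * M.trans t x y = μ y * M.trans t y x
  mem_iff : ∀ f : V → ℝ, MemL2 μ f →
    (MemDomain G μ w d α f ↔ ∃ l : ℝ, Tendsto (M.approxForm μ f) (𝓝[>] 0) (𝓝 l))
  tendsto : ∀ f : V → ℝ, MemDomain G μ w d α f →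
    Tendsto (M.approxForm μ f) (𝓝[>] 0) (𝓝 (energy G μ w d α f))

/-- The first exit time `τ_A = inf {s > 0 : X_s ∉ A}`, with `inf ∅ = ∞`. -/
noncomputable def exitTime (M : MarkovProcess V Ω) (A : Set V) (ω : Ω) : ℝ≥0∞ :=
  ⨅ s : {s : ℝ≥0 // 0 < s ∧ ∀ v ∈ A, M.X s ω ≠ some v}, ((s : ℝ≥0) : ℝ≥0∞)

/-- The transition density `P_x(X_t = y, t < τ_A) / μ_y`, with respect to `μ`, of the process killed
on exiting `A`. -/
noncomputable def killedHeatKernel (M : MarkovProcess V Ω) (μ : V → ℝ) (A : Set V) (t : ℝ≥0)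
    (x y : V) : ℝ :=
  (M.P x).real {ω | M.X t ω = some y ∧ (t : ℝ≥0∞) < M.exitTime A ω} / μ y

end MarkovProcess

end Conductance

/-! This is Nash's method, run on the scales at which the conductances are controlled. For `u ∈
B(0,R)`, averaging over `z ∈ B^w(u,r)` bounds `|f(u)|` by the mean of `|f(u) - f(z)|` plus the mean
of `|f|`. Cauchy–Schwarz with weights `w⁻¹` and `w` turns the first mean into energy, so for `f`
supported in `B(0,R)` and `S^θ ≤ r ≤ S` one gets `‖f‖₂² ≤ A r^α D(f,f) + A r^(-d) ‖f‖₁²`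
(`sum_sq_le`, `nash_of_le`). Take `S = K R` with `K` large. At `r = S` the last term is absorbed,
because `‖f‖₁² ≤ μ(B(0,R)) ‖f‖₂²`; the resulting spectral gap extends the inequality to all `r ≥ r₀
= (K R)^θ` (`nash`).

Applied to `f = p(τ,·,x)`, whose mass is at most 1, this gives `u ≤ A r^α (-u'/2) + A r^(-d)` for
`u(τ) = p(2τ,x,x)` (`exp_diag_le`). From `u(0) = 1/μ_x ≤ R^κ` the scale `r₀` forces exponential
decay until `u ≤ 2A r₀^(-d)`, which takes a time of order at most `R^(θα) log R`, negligible against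
`R^(θ'α)`. After that the scale `r ≈ u^(-1/d)` is admissible, and integrating the inequality gives
`u ≤ C τ^(-d/α)` (`le_rpow_of_nash_deriv`). The initial phase affects only `R₁`, not `C₁`. Symmetry
and the semigroup property give the off-diagonal bound (`exp_offDiag_le`).

For a process associated with the form, the form determines the derivative at 0 of the transition
function (`tendsto_trans`). Observing the process on a time grid and applying Chernoff's formula
bounds the killed density by the Dirichlet heat kernel (`killedHeatKernel_le`). -/

namespace Conductance

/-! ### Matrix exponentials and symmetric sub-Markovian semigroups on a finite set. -/

section MatrixSemigroup

variable {ι : Type*} [Fintype ι] [DecidableEq ι]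

open scoped Matrix.Norms.Operator in
theorem hasDerivAt_matrix_exp (L : Matrix ι ι ℝ) (t : ℝ) :
    HasDerivAt (fun s : ℝ => NormedSpace.exp (s • L)) (NormedSpace.exp (t • L) * L) t :=
  hasDerivAt_exp_smul_const (𝕂 := ℝ) L t

theorem hasDerivAt_matrix_exp_apply (L : Matrix ι ι ℝ) (t : ℝ) (i j : ι) :
    HasDerivAt (fun s : ℝ => NormedSpace.exp (s • L) i j)
      ((NormedSpace.exp (t • L) * L) i j) t :=
  hasDerivAt_pi.1 (hasDerivAt_pi.1 (hasDerivAt_matrix_exp L t) i) j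

open scoped Matrix.Norms.Operator in
theorem hasSum_matrix_exp (L : Matrix ι ι ℝ) :
    HasSum (fun n : ℕ => (n.factorial : ℝ)⁻¹ • L ^ n) (NormedSpace.exp L) :=
  NormedSpace.exp_series_hasSum_exp' (𝕂 := ℝ) L

theorem hasSum_matrix_exp_apply (L : Matrix ι ι ℝ) (i j : ι) :
    HasSum (fun n : ℕ => (n.factorial : ℝ)⁻¹ * (L ^ n) i j) (NormedSpace.exp L i j) :=
  Pi.hasSum.1 (Pi.hasSum.1 (hasSum_matrix_exp L) i) j

theorem matrix_exp_add_smul (L : Matrix ι ι ℝ) (s t : ℝ) :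
    NormedSpace.exp ((s + t) • L) = NormedSpace.exp (s • L) * NormedSpace.exp (t • L) := by
  rw [add_smul]
  exact Matrix.exp_add_of_commute _ _ (((Commute.refl L).smul_left s).smul_right t)

theorem matrix_exp_nonneg_of_nonneg {L : Matrix ι ι ℝ} (hL : ∀ i j, 0 ≤ L i j) (i j : ι) :
    0 ≤ NormedSpace.exp L i j := by
  have hpow : ∀ (n : ℕ) (i j : ι), 0 ≤ (L ^ n) i j := by
    intro n
    induction n with
    | zero => intro i j; rw [pow_zero, Matrix.one_apply]; positivity
    | succ n ih =>
      intro i j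
      rw [pow_succ, Matrix.mul_apply]
      exact Finset.sum_nonneg fun k _ => mul_nonneg (ih i k) (hL k j)
  exact (hasSum_matrix_exp_apply L i j).nonneg fun n => mul_nonneg (by positivity) (hpow n i j)

/-- The exponential of a matrix with nonnegative off-diagonal entries is nonnegative. -/
theorem matrix_exp_nonneg {L : Matrix ι ι ℝ} (hL : ∀ i j, i ≠ j → 0 ≤ L i j) (i j : ι) :
    0 ≤ NormedSpace.exp L i j := by
  -- This `c` makes `L + c • 1` entrywise nonnegative; scalar matrices commute with everything, so
  -- `exp L = e^(-c) exp (L + c • 1)`.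
  set c : ℝ := ∑ k, |L k k| with hc
  have h1 : L = (L + c • (1 : Matrix ι ι ℝ)) + (-c) • (1 : Matrix ι ι ℝ) := by
    rw [neg_smul, add_neg_cancel_right]
  have h2 : NormedSpace.exp ((-c) • (1 : Matrix ι ι ℝ)) = Matrix.diagonal fun _ => Real.exp (-c) := by
    rw [← Matrix.diagonal_one, ← Matrix.diagonal_smul, Matrix.exp_diagonal]
    congr 1
    ext k
    simp [Pi.coe_exp, Real.exp_eq_exp_ℝ]
  rw [h1, Matrix.exp_add_of_commute _ _ ((Commute.one_right _).smul_right _), h2,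
    Matrix.mul_diagonal]
  refine mul_nonneg (matrix_exp_nonneg_of_nonneg (fun k l => ?_) i j) (Real.exp_pos _).le
  by_cases hkl : k = l
  · subst hkl
    have : |L k k| ≤ c := Finset.single_le_sum (f := fun k => |L k k|)
      (fun _ _ => abs_nonneg _) (Finset.mem_univ k)
    have := neg_abs_le (L k k)
    simp only [Matrix.add_apply, Matrix.smul_apply, Matrix.one_apply_eq, smul_eq_mul, mul_one]
    linarith
  · simpa [Matrix.one_apply_ne hkl] using hL k l hkl

/-- `L` is the generator of a sub-Markovian semigroup on a finite set that is symmetric with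
respect to the weights `m`. -/
structure IsSubMarkovGenerator (m : ι → ℝ) (L : Matrix ι ι ℝ) : Prop where
  pos : ∀ i, 0 < m i
  offDiag : ∀ i j, i ≠ j → 0 ≤ L i j
  row : ∀ i, ∑ j, L i j ≤ 0
  symm : ∀ i j, m i * L i j = m j * L j i

namespace IsSubMarkovGenerator

variable {m : ι → ℝ} {L : Matrix ι ι ℝ}

theorem exp_nonneg (h : IsSubMarkovGenerator m L) {t : ℝ} (ht : 0 ≤ t) (i j : ι) :
    0 ≤ NormedSpace.exp (t • L) i j :=
  matrix_exp_nonneg (fun i j hij => mul_nonneg ht (h.offDiag i j hij)) i j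

/-- Row sums equal 1 at time 0, and their derivative is a nonnegative combination of the row sums of
`L`. -/
theorem exp_row (h : IsSubMarkovGenerator m L) {t : ℝ} (ht : 0 ≤ t) (i : ι) :
    ∑ j, NormedSpace.exp (t • L) i j ≤ 1 := by
  have hder : ∀ s, HasDerivAt (fun s : ℝ => ∑ j, NormedSpace.exp (s • L) i j)
      (∑ j, (NormedSpace.exp (s • L) * L) i j) s := fun s =>
    HasDerivAt.fun_sum fun j _ => hasDerivAt_matrix_exp_apply L s i j
  have hanti : AntitoneOn (fun s : ℝ => ∑ j, NormedSpace.exp (s • L) i j) (Set.Ici 0) := by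
    refine antitoneOn_of_deriv_nonpos (convex_Ici 0)
      (fun s _ => (hder s).continuousAt.continuousWithinAt)
      (fun s _ => (hder s).differentiableAt.differentiableWithinAt) fun s hs => ?_
    rw [interior_Ici] at hs
    rw [(hder s).deriv]
    simp only [Matrix.mul_apply]
    rw [Finset.sum_comm]
    refine Finset.sum_nonpos fun k _ => ?_
    rw [← Finset.mul_sum]
    exact mul_nonpos_of_nonneg_of_nonpos (h.exp_nonneg (le_of_lt hs) i k) (h.row k)
  have := hanti Set.self_mem_Ici (Set.mem_Ici.2 ht) ht
  simpa [Matrix.one_apply] using this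

/-- Conjugation by `diagonal m` takes `t • L` to its transpose, and `exp` respects both conjugation
and transposition. -/
theorem exp_symm (h : IsSubMarkovGenerator m L) (t : ℝ) (i j : ι) :
    m i * NormedSpace.exp (t • L) i j = m j * NormedSpace.exp (t • L) j i := by
  have hunit : IsUnit (Matrix.diagonal m) := by
    rw [Matrix.isUnit_diagonal, Pi.isUnit_iff]
    exact fun k => (h.pos k).ne'.isUnit
  have hdet : IsUnit (Matrix.diagonal m).det := (Matrix.isUnit_iff_isUnit_det _).1 hunit
  have h1 : Matrix.diagonal m * (t • L) = (t • L).transpose * Matrix.diagonal m := by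
    ext k l
    have := h.symm k l
    simp only [Matrix.diagonal_mul, Matrix.mul_diagonal, Matrix.smul_apply, smul_eq_mul,
      Matrix.transpose_apply]
    linear_combination t * this
  have h2 : Matrix.diagonal m * (t • L) * (Matrix.diagonal m)⁻¹ = (t • L).transpose := by
    rw [h1, Matrix.mul_nonsing_inv_cancel_right _ _ hdet]
  have h3 := Matrix.exp_conj (Matrix.diagonal m) (t • L) hunit
  rw [h2, Matrix.exp_transpose] at h3
  have h4 : (NormedSpace.exp (t • L)).transpose * Matrix.diagonal m
      = Matrix.diagonal m * NormedSpace.exp (t • L) := by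
    rw [h3, Matrix.nonsing_inv_mul_cancel_right _ _ hdet]
  have h5 := congrFun (congrFun h4 i) j
  simp only [Matrix.diagonal_mul, Matrix.mul_diagonal, Matrix.transpose_apply] at h5
  linarith

end IsSubMarkovGenerator

end MatrixSemigroup

/-! ### The differential inequality behind the polynomial decay. -/

/-- A positive function satisfying the whole family of Nash-type differential inequalities at the
scales `r ≥ r₀` decays polynomially, as soon as its exponential decay at the scale `r₀` has
had time to take effect. -/
theorem le_rpow_of_nash_deriv {u u' : ℝ → ℝ} {A r₀ α d s : ℝ} (hA : 0 < A) (hr₀ : 0 < r₀)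
    (hα : 0 < α) (hd : 0 < d) (hs : 0 < s) (hu : ∀ τ, HasDerivAt u (u' τ) τ)
    (hpos : ∀ τ, 0 ≤ τ → 0 < u τ)
    (hN : ∀ r, r₀ ≤ r → ∀ τ, 0 ≤ τ → u τ ≤ A * r ^ α * (-(u' τ) / 2) + A * r ^ (-d))
    (hexp : u 0 * Real.exp (-(s / (2 * (A * r₀ ^ α)))) ≤ 2 * A * r₀ ^ (-d)) :
    u s ≤ (α / d / (A * (2 * A) ^ (α / d)) * (s / 2)) ^ (-(d / α)) := by
  -- Below the threshold `2A r₀^(-d)` the scale `r = (2A/u)^(1/d)` is at least `r₀`. It makes `A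
  -- r^(-d) = u/2`, which is absorbed on the left.
  have hcrit : ∀ τ, 0 ≤ τ → u τ ≤ 2 * A * r₀ ^ (-d) →
      1 ≤ A * (2 * A) ^ (α / d) * (-(u' τ) * u τ ^ (-(α / d) - 1)) := by
    intro τ hτ hle
    have hup := hpos τ hτ
    have hq : 0 < 2 * A / u τ := by positivity
    have hr : r₀ ≤ (2 * A / u τ) ^ (1 / d) := by
      have h1 : r₀ ^ d ≤ 2 * A / u τ := by
        rw [le_div_iff₀ hup]
        calc r₀ ^ d * u τ ≤ r₀ ^ d * (2 * A * r₀ ^ (-d)) := by gcongr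
          _ = 2 * A * (r₀ ^ d * r₀ ^ (-d)) := by ring
          _ = 2 * A := by rw [← Real.rpow_add hr₀, add_neg_cancel, Real.rpow_zero, mul_one]
      calc r₀ = (r₀ ^ d) ^ (1 / d) := by
            rw [← Real.rpow_mul hr₀.le, mul_one_div_cancel hd.ne', Real.rpow_one]
        _ ≤ _ := Real.rpow_le_rpow (by positivity) h1 (by positivity)
    have h2 := hN _ hr τ hτ
    rw [← Real.rpow_mul hq.le, ← Real.rpow_mul hq.le,
      show 1 / d * -d = -1 by field_simp, Real.rpow_neg_one,
      show 1 / d * α = α / d by ring, Real.div_rpow (by positivity) hup.le] at h2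
    have h3 : A * (2 * A / u τ)⁻¹ = u τ / 2 := by field_simp
    rw [h3] at h2
    have h4 : u τ ^ (-(α / d) - 1) = (u τ ^ (α / d))⁻¹ / u τ := by
      rw [Real.rpow_sub_one hup.ne', Real.rpow_neg hup.le]
    rw [h4]
    have h5 : u τ ≤ A * ((2 * A) ^ (α / d) / u τ ^ (α / d)) * (-u' τ) := by linarith
    calc (1 : ℝ) = u τ / u τ := (div_self hup.ne').symm
      _ ≤ (A * ((2 * A) ^ (α / d) / u τ ^ (α / d)) * (-u' τ)) / u τ := by gcongr
      _ = _ := by ring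
  -- At a scale so large that `A r^(-d) ≤ u τ`, a positive `u' τ` would make the right side of `hN`
  -- smaller than `u τ`.
  have hderiv : ∀ τ, 0 ≤ τ → u' τ ≤ 0 := by
    intro τ hτ
    have hup := hpos τ hτ
    by_contra hcon
    push Not at hcon
    set r := max r₀ ((A / u τ) ^ (1 / d)) with hr
    have hr' : 0 < r := lt_of_lt_of_le hr₀ (le_max_left _ _)
    have h1 := hN r (le_max_left _ _) τ hτ
    have h2 : A / u τ ≤ r ^ d := by
      calc A / u τ = ((A / u τ) ^ (1 / d)) ^ d := by
            rw [← Real.rpow_mul (by positivity), one_div_mul_cancel hd.ne', Real.rpow_one]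
        _ ≤ _ := Real.rpow_le_rpow (by positivity) (le_max_right _ _) hd.le
    have h3 : A * r ^ (-d) ≤ u τ := by
      rw [Real.rpow_neg hr'.le, ← div_eq_mul_inv, div_le_iff₀ (by positivity)]
      rw [div_le_iff₀ hup] at h2
      linarith
    have h4 : 0 < A * r ^ α * u' τ := by positivity
    linarith
  have hanti : AntitoneOn u (Set.Ici 0) := by
    refine antitoneOn_of_deriv_nonpos (convex_Ici 0)
      (fun τ _ => (hu τ).continuousAt.continuousWithinAt)
      (fun τ _ => (hu τ).differentiableAt.differentiableWithinAt) fun τ hτ => ?_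
    rw [interior_Ici] at hτ
    rw [(hu τ).deriv]
    exact hderiv τ (le_of_lt hτ)
  -- Otherwise, by monotonicity, `u` exceeds the threshold on all of `[0, s/2]`. There `hN` at scale
  -- `r₀` gives `u' ≤ -u / (A r₀^α)`, and the exponential decay contradicts `hexp`.
  have hhalf : u (s / 2) ≤ 2 * A * r₀ ^ (-d) := by
    by_contra hcon
    push Not at hcon
    have hc : 0 < A * r₀ ^ α := by positivity
    have hder : ∀ τ, HasDerivAt (fun τ => u τ * Real.exp (τ / (A * r₀ ^ α)))
        (u' τ * Real.exp (τ / (A * r₀ ^ α)) +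
          u τ * (Real.exp (τ / (A * r₀ ^ α)) * (1 / (A * r₀ ^ α)))) τ := fun τ =>
      (hu τ).mul (((hasDerivAt_id τ).div_const _).exp)
    have hanti2 : AntitoneOn (fun τ => u τ * Real.exp (τ / (A * r₀ ^ α))) (Set.Icc 0 (s / 2)) := by
      refine antitoneOn_of_deriv_nonpos (convex_Icc _ _)
        (fun τ _ => (hder τ).continuousAt.continuousWithinAt)
        (fun τ _ => (hder τ).differentiableAt.differentiableWithinAt) fun τ hτ => ?_
      rw [interior_Icc] at hτ
      rw [(hder τ).deriv]
      have h1 := hN r₀ le_rfl τ hτ.1.le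
      have h2 : u (s / 2) ≤ u τ := hanti (Set.mem_Ici.2 hτ.1.le)
        (Set.mem_Ici.2 (by positivity)) hτ.2.le
      have h3 : u' τ + u τ / (A * r₀ ^ α) ≤ 0 := by
        have : u τ / (A * r₀ ^ α) ≤ -u' τ := by
          rw [div_le_iff₀ hc]
          linarith
        linarith
      calc _ = (u' τ + u τ / (A * r₀ ^ α)) * Real.exp (τ / (A * r₀ ^ α)) := by ring
        _ ≤ 0 := mul_nonpos_of_nonpos_of_nonneg h3 (Real.exp_pos _).le
    have h1 := hanti2 (Set.left_mem_Icc.2 (by positivity)) (Set.right_mem_Icc.2 (by positivity))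
      (by positivity : (0 : ℝ) ≤ s / 2)
    simp only [zero_div, Real.exp_zero, mul_one] at h1
    have h2 : s / 2 / (A * r₀ ^ α) = s / (2 * (A * r₀ ^ α)) := by field_simp
    rw [h2] at h1
    have h3 : u (s / 2) ≤ u 0 * Real.exp (-(s / (2 * (A * r₀ ^ α)))) := by
      rw [Real.exp_neg, ← div_eq_mul_inv, le_div_iff₀ (Real.exp_pos _)]
      exact h1
    linarith
  -- By `hcrit`, `u^(-α/d)` grows at least at rate `b` on `[s/2, s]`.
  set b := α / d / (A * (2 * A) ^ (α / d)) with hb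
  have hb0 : 0 < b := by positivity
  have hder : ∀ τ, 0 ≤ τ → HasDerivAt (fun τ => u τ ^ (-(α / d)) - b * τ)
      (u' τ * (-(α / d)) * u τ ^ (-(α / d) - 1) - b * 1) τ := fun τ hτ =>
    ((hu τ).rpow_const (Or.inl (hpos τ hτ).ne')).sub ((hasDerivAt_id τ).const_mul b)
  have hmono : MonotoneOn (fun τ => u τ ^ (-(α / d)) - b * τ) (Set.Icc (s / 2) s) := by
    have hnn : ∀ τ ∈ Set.Icc (s / 2) s, 0 ≤ τ := fun τ hτ => le_trans (by positivity) hτ.1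
    refine monotoneOn_of_deriv_nonneg (convex_Icc _ _)
      (fun τ hτ => (hder τ (hnn τ hτ)).continuousAt.continuousWithinAt)
      (fun τ hτ => (hder τ (hnn τ (interior_subset hτ))).differentiableAt.differentiableWithinAt)
      fun τ hτ => ?_
    replace hτ := interior_subset hτ
    rw [(hder τ (hnn τ hτ)).deriv]
    have h1 := hcrit τ (hnn τ hτ)
      ((hanti (Set.mem_Ici.2 (by positivity)) (Set.mem_Ici.2 (hnn τ hτ)) hτ.1).trans hhalf)
    have hc : 0 < A * (2 * A) ^ (α / d) := by positivity
    have h2 : b ≤ α / d * (-(u' τ) * u τ ^ (-(α / d) - 1)) := by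
      rw [hb, div_le_iff₀ hc]
      have : 0 < α / d := by positivity
      nlinarith
    linarith
  have h1 := hmono (Set.left_mem_Icc.2 (by linarith)) (Set.right_mem_Icc.2 (by linarith))
    (by linarith)
  simp only at h1
  have h2 : 0 < u (s / 2) ^ (-(α / d)) := Real.rpow_pos_of_pos (hpos _ (by positivity)) _
  have h3 : b * (s / 2) ≤ u s ^ (-(α / d)) := by linarith
  calc u s = (u s ^ (-(α / d))) ^ (-(d / α)) := by
        rw [← Real.rpow_mul (hpos s hs.le).le, show -(α / d) * -(d / α) = 1 by field_simp,
          Real.rpow_one]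
    _ ≤ _ := Real.rpow_le_rpow_of_nonpos (by positivity) h3 (by
        have : 0 < d / α := by positivity
        linarith)

/-! ### From Nash inequalities to heat kernel bounds on a finite set. -/

section MatrixSemigroup

variable {ι : Type*} [Fintype ι] [DecidableEq ι]

namespace IsSubMarkovGenerator

variable {m : ι → ℝ} {L : Matrix ι ι ℝ}

theorem sum_sq_exp_mul (h : IsSubMarkovGenerator m L) (t : ℝ) (x : ι) :
    ∑ y, (NormedSpace.exp (t • L) y x / m x) ^ 2 * m y =
      NormedSpace.exp ((t + t) • L) x x / m x := by
  rw [matrix_exp_add_smul, Matrix.mul_apply, Finset.sum_div]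
  refine Finset.sum_congr rfl fun y _ => ?_
  have h1 := h.exp_symm t x y
  have hx := (h.pos x).ne'
  field_simp
  linear_combination (NormedSpace.exp (t • L) y x) * -h1

/-- For `f = p(t,·,x)` this is `⟨f, L f⟩`, half the time derivative of `‖f‖₂² = p(2t,x,x)`. -/
theorem energy_exp (h : IsSubMarkovGenerator m L) (t : ℝ) (x : ι) :
    ∑ i, m i * (NormedSpace.exp (t • L) i x / m x) *
        ∑ j, L i j * (NormedSpace.exp (t • L) j x / m x) =
      (NormedSpace.exp ((t + t) • L) * L) x x / m x := by
  have hcomm : NormedSpace.exp (t • L) * L = L * NormedSpace.exp (t • L) :=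
    (((Commute.refl L).smul_left t).exp_left).eq
  rw [matrix_exp_add_smul, mul_assoc, hcomm, Matrix.mul_apply, Finset.sum_div]
  refine Finset.sum_congr rfl fun i _ => ?_
  have h1 := h.exp_symm t x i
  have hx := (h.pos x).ne'
  have h2 : ∑ j, L i j * (NormedSpace.exp (t • L) j x / m x) =
      (L * NormedSpace.exp (t • L)) i x / m x := by
    rw [Matrix.mul_apply, Finset.sum_div]
    exact Finset.sum_congr rfl fun j _ => (mul_div_assoc _ _ _).symm
  rw [h2]
  field_simp
  linear_combination (L * NormedSpace.exp (t • L)) i x * -h1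

/-- If this squared norm vanished, so would column `x` of `exp (t • L)`, which is invertible.
Positivity permits the negative powers of `u` in `le_rpow_of_nash_deriv`. -/
theorem exp_diag_pos (h : IsSubMarkovGenerator m L) (t : ℝ) (x : ι) :
    0 < NormedSpace.exp ((t + t) • L) x x / m x := by
  rw [← h.sum_sq_exp_mul]
  by_contra hcon
  have hnn : ∀ y ∈ Finset.univ, 0 ≤ (NormedSpace.exp (t • L) y x / m x) ^ 2 * m y :=
    fun y _ => mul_nonneg (sq_nonneg _) (h.pos y).le
  have h0 := (Finset.sum_eq_zero_iff_of_nonneg hnn).1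
    (le_antisymm (not_lt.1 hcon) (Finset.sum_nonneg hnn))
  have h1 : ∀ y, NormedSpace.exp (t • L) y x = 0 := by
    intro y
    have := h0 y (Finset.mem_univ _)
    have hy := (h.pos y).ne'
    have hx := (h.pos x).ne'
    simpa [hy, hx] using this
  have h2 : (NormedSpace.exp ((-t + t) • L)) x x = 0 := by
    rw [matrix_exp_add_smul, Matrix.mul_apply]
    exact Finset.sum_eq_zero fun y _ => by rw [h1, mul_zero]
  simp at h2

/-- On-diagonal decay of a symmetric sub-Markovian semigroup from Nash-type inequalities at all
scales `r ≥ r₀`. -/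
theorem exp_diag_le (h : IsSubMarkovGenerator m L) {A r₀ α d s : ℝ} (hA : 0 < A) (hr₀ : 0 < r₀)
    (hα : 0 < α) (hd : 0 < d) (hs : 0 < s)
    (hN : ∀ r, r₀ ≤ r → ∀ f : ι → ℝ, ∑ i, f i ^ 2 * m i ≤
      A * r ^ α * (-∑ i, m i * f i * ∑ j, L i j * f j) + A * r ^ (-d) * (∑ i, |f i| * m i) ^ 2)
    (x : ι) (hexp : (m x)⁻¹ * Real.exp (-(s / (2 * (A * r₀ ^ α)))) ≤ 2 * A * r₀ ^ (-d)) :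
    NormedSpace.exp ((s + s) • L) x x / m x ≤
      (α / d / (A * (2 * A) ^ (α / d)) * (s / 2)) ^ (-(d / α)) := by
  have hder : ∀ τ, HasDerivAt (fun τ : ℝ => NormedSpace.exp ((τ + τ) • L) x x / m x)
      (2 * ((NormedSpace.exp ((τ + τ) • L) * L) x x / m x)) τ := by
    intro τ
    have h0 : HasDerivAt (fun τ : ℝ => τ + τ) (1 + 1) τ := (hasDerivAt_id τ).add (hasDerivAt_id τ)
    have h1 := (hasDerivAt_matrix_exp_apply L (τ + τ) x x).comp (h := fun τ : ℝ => τ + τ) τ h0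
    refine (h1.div_const (m x)).congr_deriv ?_
    ring
  refine le_rpow_of_nash_deriv (r₀ := r₀) hA hr₀ hα hd hs hder (fun τ _ => h.exp_diag_pos τ x)
    (fun r hr τ hτ => ?_) (by simpa using hexp)
  have h1 := hN r hr fun y => NormedSpace.exp (τ • L) y x / m x
  rw [h.sum_sq_exp_mul, h.energy_exp] at h1
  -- By symmetry the mass of `p(τ,·,x)` is the row sum of `exp (τ • L)` at `x`.
  have h2 : ∑ i, |NormedSpace.exp (τ • L) i x / m x| * m i ≤ 1 := by
    refine le_trans (le_of_eq ?_) (h.exp_row hτ x)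
    refine Finset.sum_congr rfl fun y _ => ?_
    rw [abs_of_nonneg (div_nonneg (h.exp_nonneg hτ _ _) (h.pos x).le)]
    have h1 := h.exp_symm τ x y
    have hx := (h.pos x).ne'
    field_simp
    linear_combination -h1
  have h3 : (∑ i, |NormedSpace.exp (τ • L) i x / m x| * m i) ^ 2 ≤ 1 :=
    pow_le_one₀ (Finset.sum_nonneg fun i _ => mul_nonneg (abs_nonneg _) (h.pos i).le) h2
  have hr' : 0 < r := lt_of_lt_of_le hr₀ hr
  have h4 : 0 < A * r ^ (-d) := by positivity
  calc _ ≤ _ := h1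
    _ ≤ A * r ^ α * (-((NormedSpace.exp ((τ + τ) • L) * L) x x / m x)) + A * r ^ (-d) * 1 := by
        gcongr
    _ = _ := by ring

/-- `p(2s,x,y)` is the inner product of `p(s,·,x)` and `p(s,·,y)`, hence at most the mean of the two
diagonal values. -/
theorem exp_offDiag_le (h : IsSubMarkovGenerator m L) (s : ℝ) (x y : ι) {B : ℝ}
    (hx : NormedSpace.exp ((s + s) • L) x x / m x ≤ B)
    (hy : NormedSpace.exp ((s + s) • L) y y / m y ≤ B) :
    NormedSpace.exp ((s + s) • L) x y / m y ≤ B := by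
  have key : NormedSpace.exp ((s + s) • L) x y / m y =
      ∑ z, (NormedSpace.exp (s • L) z x / m x) * (NormedSpace.exp (s • L) z y / m y) * m z := by
    rw [matrix_exp_add_smul, Matrix.mul_apply, Finset.sum_div]
    refine Finset.sum_congr rfl fun z _ => ?_
    have h1 := h.exp_symm s x z
    have hx := (h.pos x).ne'
    have hy := (h.pos y).ne'
    field_simp
    linear_combination NormedSpace.exp (s • L) z y * h1
  rw [← h.sum_sq_exp_mul] at hx hy
  rw [key]
  have h2 : ∑ z, (NormedSpace.exp (s • L) z x / m x) * (NormedSpace.exp (s • L) z y / m y) * m z ≤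
      ∑ z, ((NormedSpace.exp (s • L) z x / m x) ^ 2 * m z +
        (NormedSpace.exp (s • L) z y / m y) ^ 2 * m z) / 2 := by
    refine Finset.sum_le_sum fun z _ => ?_
    have h1 := mul_nonneg (sq_nonneg
      (NormedSpace.exp (s • L) z x / m x - NormedSpace.exp (s • L) z y / m y)) (h.pos z).le
    linarith
  rw [← Finset.sum_div, Finset.sum_add_distrib] at h2
  linarith

end IsSubMarkovGenerator

end MatrixSemigroup

/-! ### The Dirichlet generator and the Nash inequality at one scale. -/

section DirichletForm

variable {V : Type*} {G : SimpleGraph V} {μ : V → ℝ} {w : V → V → ℝ} {d α : ℝ}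

namespace IsConductance

theorem jump_nonneg (hw : IsConductance G μ w d α) (x y : V) : 0 ≤ jump G w d α x y :=
  div_nonneg (hw.nonneg x y) (by positivity)

theorem jump_self (hw : IsConductance G μ w d α) (x : V) : jump G w d α x x = 0 := by
  rw [jump, hw.diag, zero_div]

theorem jump_symm (hw : IsConductance G μ w d α) (x y : V) :
    jump G w d α x y = jump G w d α y x := by
  rw [jump, jump, hw.symm, G.dist_comm]

theorem generator_single_of_ne [DecidableEq V] {x y : V} (hxy : x ≠ y) :
    generator G μ w d α (Pi.single y 1) x = jump G w d α x y * μ y := by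
  rw [generator, tsum_eq_single y fun z hz => by simp [hxy, hz]]
  simp [hxy]

theorem generator_single_self [DecidableEq V] (hw : IsConductance G μ w d α) (x : V) :
    generator G μ w d α (Pi.single x 1) x = -∑' z, jump G w d α x z * μ z := by
  rw [generator, ← tsum_neg]
  refine tsum_congr fun z => ?_
  by_cases hz : z = x
  · subst hz; simp [hw.jump_self]
  · simp [hz]

open Classical in
theorem dirichletGenerator_apply (hw : IsConductance G μ w d α) {A : Set V} (x y : A) :
    dirichletGenerator G μ w d α A x y =
      jump G w d α x y * μ y - if x = y then ∑' z, jump G w d α x z * μ z else 0 := by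
  rw [dirichletGenerator, Matrix.of_apply]
  by_cases hxy : x = y
  · subst hxy
    rw [hw.generator_single_self, hw.jump_self, if_pos rfl]
    ring
  · rw [generator_single_of_ne (fun h => hxy (Subtype.ext h)), if_neg hxy, sub_zero]

theorem sum_dirichletGenerator (hw : IsConductance G μ w d α) {A : Set V} [Fintype A]
    (x : A) (f : A → ℝ) :
    ∑ y, dirichletGenerator G μ w d α A x y * f y =
      ∑ y : A, jump G w d α x y * μ y * f y - (∑' z, jump G w d α x z * μ z) * f x := by
  classical
  simp only [hw.dirichletGenerator_apply, sub_mul, ite_mul, zero_mul, Finset.sum_sub_distrib,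
    Finset.sum_ite_eq, Finset.mem_univ, if_true]

theorem sum_jump_le (hw : IsConductance G μ w d α) (hμ : ∀ x, 0 < μ x) (x : V) (s : Finset V) :
    ∑ z ∈ s, jump G w d α x z * μ z ≤ ∑' z, jump G w d α x z * μ z :=
  (hw.summable x).sum_le_tsum s fun z _ => mul_nonneg (hw.jump_nonneg x z) (hμ z).le

/-- Each row sum is minus the rate of jumping out of `A`. -/
theorem isSubMarkovGenerator (hw : IsConductance G μ w d α) (hμ : ∀ x, 0 < μ x) {A : Set V}
    [Fintype A] : IsSubMarkovGenerator (fun x : A => μ x) (dirichletGenerator G μ w d α A) where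
  pos x := hμ x
  offDiag x y hxy := by
    rw [hw.dirichletGenerator_apply, if_neg hxy, sub_zero]
    exact mul_nonneg (hw.jump_nonneg _ _) (hμ _).le
  row x := by
    have h1 := hw.sum_dirichletGenerator x fun _ => 1
    simp only [mul_one] at h1
    rw [h1]
    have h2 := hw.sum_jump_le hμ x A.toFinset
    rw [← Finset.sum_set_coe] at h2
    linarith
  symm x y := by
    rw [hw.dirichletGenerator_apply, hw.dirichletGenerator_apply, hw.jump_symm y x]
    by_cases hxy : x = y
    · subst hxy; ring
    · rw [if_neg hxy, if_neg (Ne.symm hxy)]; ring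

/-- The part of the energy carried by pairs `(u, z)` with `u ∈ A` and `z` in a window around `u`
is controlled by the Dirichlet form. -/
theorem sum_window_le (hw : IsConductance G μ w d α) (hμ : ∀ x, 0 < μ x) (A : Finset V)
    (W : V → Finset V) (f : V → ℝ) (hf : ∀ v, v ∉ A → f v = 0) :
    ∑ u ∈ A, μ u * ∑ z ∈ W u, (f u - f z) ^ 2 * (jump G w d α u z * μ z) ≤
      2 * ∑ u ∈ A, μ u * f u * ((∑' z, jump G w d α u z * μ z) * f u -
        ∑ z ∈ A, jump G w d α u z * μ z * f z) := by
  classical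
  have hJ : ∀ u z, 0 ≤ jump G w d α u z * μ z := fun u z => mul_nonneg (hw.jump_nonneg u z) (hμ z).le
  -- Expand the square over `W u ∪ A`: the terms containing `f z` vanish off `A`, and the
  -- coefficient of `f u ^ 2` is at most the total jump rate. Windows may therefore leave `A`.
  have h1 : ∀ u, ∑ z ∈ W u, (f u - f z) ^ 2 * (jump G w d α u z * μ z) ≤
      ∑ z ∈ A, (f z ^ 2 - 2 * f u * f z) * (jump G w d α u z * μ z) +
        f u ^ 2 * ∑' z, jump G w d α u z * μ z := by
    intro u
    have h2 : ∑ z ∈ W u, (f u - f z) ^ 2 * (jump G w d α u z * μ z) ≤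
        ∑ z ∈ W u ∪ A, (f u - f z) ^ 2 * (jump G w d α u z * μ z) :=
      Finset.sum_le_sum_of_subset_of_nonneg Finset.subset_union_left
        fun z _ _ => mul_nonneg (sq_nonneg _) (hJ u z)
    have h3 : ∑ z ∈ W u ∪ A, (f u - f z) ^ 2 * (jump G w d α u z * μ z) =
        ∑ z ∈ W u ∪ A, (f z ^ 2 - 2 * f u * f z) * (jump G w d α u z * μ z) +
          f u ^ 2 * ∑ z ∈ W u ∪ A, jump G w d α u z * μ z := by
      rw [Finset.mul_sum, ← Finset.sum_add_distrib]
      exact Finset.sum_congr rfl fun z _ => by ring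
    have h4 : ∑ z ∈ W u ∪ A, (f z ^ 2 - 2 * f u * f z) * (jump G w d α u z * μ z) =
        ∑ z ∈ A, (f z ^ 2 - 2 * f u * f z) * (jump G w d α u z * μ z) :=
      (Finset.sum_subset Finset.subset_union_right fun z _ hz => by rw [hf z hz]; ring).symm
    have h5 := mul_le_mul_of_nonneg_left (hw.sum_jump_le hμ u (W u ∪ A)) (sq_nonneg (f u))
    linarith
  have hsymm : ∑ u ∈ A, ∑ z ∈ A, μ u * (f z ^ 2 * (jump G w d α u z * μ z)) =
      ∑ u ∈ A, μ u * f u ^ 2 * ∑ z ∈ A, jump G w d α u z * μ z := by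
    rw [Finset.sum_comm]
    refine Finset.sum_congr rfl fun z _ => ?_
    rw [Finset.mul_sum]
    refine Finset.sum_congr rfl fun u _ => ?_
    rw [hw.jump_symm u z]
    ring
  have hbd : ∑ u ∈ A, μ u * f u ^ 2 * ∑ z ∈ A, jump G w d α u z * μ z ≤
      ∑ u ∈ A, μ u * f u ^ 2 * ∑' z, jump G w d α u z * μ z :=
    Finset.sum_le_sum fun u _ => mul_le_mul_of_nonneg_left (hw.sum_jump_le hμ u A)
      (mul_nonneg (hμ u).le (sq_nonneg _))
  calc _ ≤ ∑ u ∈ A, μ u * (∑ z ∈ A, (f z ^ 2 - 2 * f u * f z) * (jump G w d α u z * μ z) +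
        f u ^ 2 * ∑' z, jump G w d α u z * μ z) :=
        Finset.sum_le_sum fun u _ => mul_le_mul_of_nonneg_left (h1 u) (hμ u).le
    _ = ∑ u ∈ A, ∑ z ∈ A, μ u * (f z ^ 2 * (jump G w d α u z * μ z)) +
        ∑ u ∈ A, μ u * f u ^ 2 * ∑' z, jump G w d α u z * μ z -
        2 * ∑ u ∈ A, μ u * f u * ∑ z ∈ A, jump G w d α u z * μ z * f z := by
        rw [Finset.mul_sum, ← Finset.sum_add_distrib, ← Finset.sum_sub_distrib]
        refine Finset.sum_congr rfl fun u _ => ?_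
        simp only [sub_mul, Finset.sum_sub_distrib, ← Finset.mul_sum]
        have : ∑ z ∈ A, 2 * f u * f z * (jump G w d α u z * μ z) =
            2 * f u * ∑ z ∈ A, jump G w d α u z * μ z * f z := by
          rw [Finset.mul_sum]
          exact Finset.sum_congr rfl fun z _ => by ring
        rw [this]
        ring
    _ ≤ 2 * ∑ u ∈ A, μ u * f u ^ 2 * ∑' z, jump G w d α u z * μ z -
        2 * ∑ u ∈ A, μ u * f u * ∑ z ∈ A, jump G w d α u z * μ z * f z := by
        rw [hsymm]; linarith
    _ = _ := by
        rw [← mul_sub, ← Finset.sum_sub_distrib]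
        congr 1
        exact Finset.sum_congr rfl fun u _ => by ring

/-- Nash-type inequality at the scale `r` for functions supported in `A`. -/
theorem sum_sq_le (hw : IsConductance G μ w d α) (hμ : ∀ x, 0 < μ x) (A : Finset V)
    (W : V → Finset V) (f : V → ℝ) (hf : ∀ v, v ∉ A → f v = 0) {r b C₀ c : ℝ} (hr : 0 < r)
    (hb : 0 < b) (hdα : 0 ≤ d + α) (hconn : G.Connected)
    (hvol : ∀ u ∈ A, b * r ^ d ≤ ∑ z ∈ W u, μ z)
    (hpos : ∀ u ∈ A, ∀ z ∈ W u, 0 < w u z)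
    (hdist : ∀ u ∈ A, ∀ z ∈ W u, (G.dist u z : ℝ) ≤ r)
    (hinv : ∀ u ∈ A, ∑ z ∈ W u, (w u z)⁻¹ * μ z ≤ C₀ * r ^ d)
    (hup : ∀ z ∈ A, ∀ s ⊆ A, (∀ u ∈ s, z ∈ W u) → ∑ u ∈ s, μ u ≤ c * r ^ d) :
    ∑ u ∈ A, f u ^ 2 * μ u ≤
      4 * C₀ / b ^ 2 * r ^ α * ∑ u ∈ A, μ u * f u * ((∑' z, jump G w d α u z * μ z) * f u -
        ∑ z ∈ A, jump G w d α u z * μ z * f z) +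
      2 * c / b ^ 2 * r ^ (-d) * (∑ u ∈ A, |f u| * μ u) ^ 2 := by
  classical
  set N := ∑ u ∈ A, |f u| * μ u with hN
  have hterm : ∀ z, 0 ≤ |f z| * μ z := fun z => mul_nonneg (abs_nonneg _) (hμ z).le
  have hN0 : 0 ≤ N := Finset.sum_nonneg fun z _ => hterm z
  have hWA : ∀ u, ∑ z ∈ W u, |f z| * μ z = ∑ z ∈ A, if z ∈ W u then |f z| * μ z else 0 := by
    intro u
    rw [← Finset.sum_filter]
    symm
    refine Finset.sum_subset_zero_on_sdiff ?_ ?_ fun _ _ => rfl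
    · intro z hz; exact (Finset.mem_filter.1 hz).2
    · intro z hz
      rw [Finset.mem_sdiff, Finset.mem_filter, not_and'] at hz
      rw [hf z (hz.2 hz.1), abs_zero, zero_mul]
  have hWN : ∀ u, ∑ z ∈ W u, |f z| * μ z ≤ N := by
    intro u
    rw [hWA]
    refine Finset.sum_le_sum fun z _ => ?_
    split_ifs
    · exact le_rfl
    · exact hterm z
  have hpoint : ∀ u ∈ A, (b * r ^ d) ^ 2 * f u ^ 2 ≤
      2 * (C₀ * r ^ d * (r ^ (d + α) *
        ∑ z ∈ W u, (f u - f z) ^ 2 * (jump G w d α u z * μ z))) +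
      2 * (N * ∑ z ∈ W u, |f z| * μ z) := by
    intro u hu
    have h1 : b * r ^ d * |f u| ≤ ∑ z ∈ W u, |f u - f z| * μ z + ∑ z ∈ W u, |f z| * μ z := by
      calc b * r ^ d * |f u| ≤ (∑ z ∈ W u, μ z) * |f u| :=
            mul_le_mul_of_nonneg_right (hvol u hu) (abs_nonneg _)
        _ = ∑ z ∈ W u, |f u| * μ z := by
            rw [Finset.sum_mul]; exact Finset.sum_congr rfl fun z _ => mul_comm _ _
        _ ≤ ∑ z ∈ W u, (|f u - f z| * μ z + |f z| * μ z) := by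
            refine Finset.sum_le_sum fun z _ => ?_
            rw [← add_mul]
            refine mul_le_mul_of_nonneg_right ?_ (hμ z).le
            calc |f u| = |(f u - f z) + f z| := by rw [sub_add_cancel]
              _ ≤ _ := abs_add_le _ _
        _ = _ := Finset.sum_add_distrib
    -- Cauchy–Schwarz after splitting `μ` into `√(w⁻¹ μ) √(w μ)`; this is where the bound on the
    -- inverse conductances enters.
    have h2 : (∑ z ∈ W u, |f u - f z| * μ z) ^ 2 ≤
        (∑ z ∈ W u, (w u z)⁻¹ * μ z) * ∑ z ∈ W u, (f u - f z) ^ 2 * (w u z * μ z) := by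
      refine Finset.sum_sq_le_sum_mul_sum_of_sq_le_mul _
        (fun z _ => mul_nonneg (inv_nonneg.2 (hw.nonneg u z)) (hμ z).le)
        (fun z _ => mul_nonneg (sq_nonneg _) (mul_nonneg (hw.nonneg u z) (hμ z).le))
        fun z hz => ?_
      have := (hpos u hu z hz).ne'
      rw [mul_pow, sq_abs]
      refine le_of_eq ?_
      field_simp
    have h3 : ∑ z ∈ W u, (f u - f z) ^ 2 * (w u z * μ z) ≤
        r ^ (d + α) * ∑ z ∈ W u, (f u - f z) ^ 2 * (jump G w d α u z * μ z) := by
      rw [Finset.mul_sum]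
      refine Finset.sum_le_sum fun z hz => ?_
      have hne : u ≠ z := by
        rintro rfl
        exact (hpos u hu u hz).ne' (hw.diag u)
      have hd0 : (0 : ℝ) < G.dist u z := by
        exact_mod_cast hconn.pos_dist_of_ne hne
      have h4 : w u z ≤ r ^ (d + α) * jump G w d α u z := by
        rw [jump, mul_div_assoc', le_div_iff₀ (by positivity), mul_comm]
        exact mul_le_mul_of_nonneg_right (Real.rpow_le_rpow hd0.le (hdist u hu z hz) hdα)
          (hw.nonneg u z)
      calc (f u - f z) ^ 2 * (w u z * μ z) ≤
          (f u - f z) ^ 2 * (r ^ (d + α) * jump G w d α u z * μ z) := by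
            have := (hμ z).le
            gcongr
        _ = _ := by ring
    have hS : 0 ≤ ∑ z ∈ W u, (f u - f z) ^ 2 * (w u z * μ z) :=
      Finset.sum_nonneg fun z _ =>
        mul_nonneg (sq_nonneg _) (mul_nonneg (hw.nonneg u z) (hμ z).le)
    have hC : 0 ≤ C₀ * r ^ d := le_trans (Finset.sum_nonneg fun z _ =>
      mul_nonneg (inv_nonneg.2 (hw.nonneg u z)) (hμ z).le) (hinv u hu)
    have h5 : (∑ z ∈ W u, |f u - f z| * μ z) ^ 2 ≤ C₀ * r ^ d * (r ^ (d + α) *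
        ∑ z ∈ W u, (f u - f z) ^ 2 * (jump G w d α u z * μ z)) :=
      h2.trans ((mul_le_mul_of_nonneg_right (hinv u hu) hS).trans
        (mul_le_mul_of_nonneg_left h3 hC))
    have h0 : 0 ≤ ∑ z ∈ W u, |f z| * μ z := Finset.sum_nonneg fun z _ => hterm z
    have h6 : (∑ z ∈ W u, |f z| * μ z) ^ 2 ≤ N * ∑ z ∈ W u, |f z| * μ z := by
      rw [sq]; exact mul_le_mul_of_nonneg_right (hWN u) h0
    calc (b * r ^ d) ^ 2 * f u ^ 2 = (b * r ^ d * |f u|) ^ 2 := by rw [mul_pow _ |f u|, sq_abs]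
      _ ≤ (∑ z ∈ W u, |f u - f z| * μ z + ∑ z ∈ W u, |f z| * μ z) ^ 2 :=
          pow_le_pow_left₀ (by positivity) h1 2
      _ ≤ 2 * (∑ z ∈ W u, |f u - f z| * μ z) ^ 2 + 2 * (∑ z ∈ W u, |f z| * μ z) ^ 2 := by
          linarith [sq_nonneg (∑ z ∈ W u, |f u - f z| * μ z - ∑ z ∈ W u, |f z| * μ z)]
      _ ≤ _ := by linarith
  -- After exchanging the sums, each `z` is weighted by the mass of the `u` whose window contains
  -- it, which `hup` bounds.
  have hsumN : ∑ u ∈ A, μ u * ∑ z ∈ W u, |f z| * μ z ≤ N * (c * r ^ d) := by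
    calc ∑ u ∈ A, μ u * ∑ z ∈ W u, |f z| * μ z
        = ∑ z ∈ A, |f z| * μ z * ∑ u ∈ A with z ∈ W u, μ u := by
          simp only [hWA, Finset.mul_sum, Finset.sum_filter]
          rw [Finset.sum_comm]
          refine Finset.sum_congr rfl fun z _ => Finset.sum_congr rfl fun u _ => ?_
          split_ifs <;> ring
      _ ≤ ∑ z ∈ A, |f z| * μ z * (c * r ^ d) := by
          refine Finset.sum_le_sum fun z hz => mul_le_mul_of_nonneg_left ?_ (hterm z)
          exact hup z hz _ (Finset.filter_subset _ _) fun u hu => (Finset.mem_filter.1 hu).2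
      _ = _ := by rw [← Finset.sum_mul]
  by_cases hA : A.Nonempty
  swap
  · rw [Finset.not_nonempty_iff_eq_empty] at hA
    simp [hN, hA]
  have hC : 0 ≤ C₀ * r ^ d := by
    obtain ⟨u, hu⟩ := hA
    exact le_trans (Finset.sum_nonneg fun z _ =>
      mul_nonneg (inv_nonneg.2 (hw.nonneg u z)) (hμ z).le) (hinv u hu)
  set E := ∑ u ∈ A, μ u * f u * ((∑' z, jump G w d α u z * μ z) * f u -
    ∑ z ∈ A, jump G w d α u z * μ z * f z) with hE
  have hwin := hw.sum_window_le hμ A W f hf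
  have hmain : (b * r ^ d) ^ 2 * ∑ u ∈ A, f u ^ 2 * μ u ≤
      2 * (C₀ * r ^ d * (r ^ (d + α) * (2 * E))) + 2 * (N * (N * (c * r ^ d))) := by
    calc (b * r ^ d) ^ 2 * ∑ u ∈ A, f u ^ 2 * μ u
        = ∑ u ∈ A, ((b * r ^ d) ^ 2 * f u ^ 2) * μ u := by
          rw [Finset.mul_sum]; exact Finset.sum_congr rfl fun u _ => by ring
      _ ≤ ∑ u ∈ A, (2 * (C₀ * r ^ d * (r ^ (d + α) *
            ∑ z ∈ W u, (f u - f z) ^ 2 * (jump G w d α u z * μ z))) +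
          2 * (N * ∑ z ∈ W u, |f z| * μ z)) * μ u :=
          Finset.sum_le_sum fun u hu => mul_le_mul_of_nonneg_right (hpoint u hu) (hμ u).le
      _ = 2 * (C₀ * r ^ d * (r ^ (d + α) *
            ∑ u ∈ A, μ u * ∑ z ∈ W u, (f u - f z) ^ 2 * (jump G w d α u z * μ z))) +
          2 * (N * ∑ u ∈ A, μ u * ∑ z ∈ W u, |f z| * μ z) := by
          rw [Finset.mul_sum A, Finset.mul_sum A, Finset.mul_sum A, Finset.mul_sum A,
            Finset.mul_sum A, ← Finset.sum_add_distrib]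
          exact Finset.sum_congr rfl fun u _ => by ring
      _ ≤ _ := by gcongr
  have hrd : 0 < r ^ d := by positivity
  have hrew : 2 * (C₀ * r ^ d * (r ^ (d + α) * (2 * E))) + 2 * (N * (N * (c * r ^ d))) =
      (b * r ^ d) ^ 2 * (4 * C₀ / b ^ 2 * r ^ α * E + 2 * c / b ^ 2 * r ^ (-d) * N ^ 2) := by
    rw [Real.rpow_add hr, Real.rpow_neg hr.le]
    field_simp
    ring
  rw [hrew] at hmain
  exact le_of_mul_le_mul_left hmain (by positivity)

end IsConductance

end DirichletForm

/-! ### Nash inequalities on balls, first up to the scale `S`, then at all large scales. -/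

section Nash

variable {V : Type*} {G : SimpleGraph V} {μ : V → ℝ} {w : V → V → ℝ} {d α : ℝ}

theorem sum_le_vol (hμ : ∀ x, 0 < μ x) {B : Set V} (hB : B.Finite) {s : Finset V}
    (hs : ∀ x ∈ s, x ∈ B) : ∑ x ∈ s, μ x ≤ vol μ B := by
  rw [vol, finsum_mem_eq_finite_toFinset_sum _ hB]
  exact Finset.sum_le_sum_of_subset_of_nonneg (fun x hx => hB.mem_toFinset.2 (hs x hx))
    fun x _ _ => (hμ x).le

/-- The constant in the Nash-type inequalities. -/
noncomputable def nashConst (cμ c₀ C₀ : ℝ) : ℝ := (4 * C₀ + 2 * cμ) / (c₀ * cμ⁻¹) ^ 2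

theorem nashConst_pos {cμ c₀ C₀ : ℝ} (hcμ : 1 ≤ cμ) (hc₀ : 0 < c₀) (hC₀ : 0 < C₀) :
    0 < nashConst cμ c₀ C₀ := by
  unfold nashConst
  positivity

/-- The second assumption on the conductances at the scale `S`. -/
def HasManyConductances (G : SimpleGraph V) (μ : V → ℝ) (w : V → V → ℝ) (o : V)
    (d θ c₀ C₀ S : ℝ) : Prop :=
  ∀ r : ℝ, S ^ θ ≤ r → r ≤ S → ∀ x ∈ ball G o (2 * S),
    c₀ * vol μ (ball G x r) ≤ vol μ (wball G w x x r) ∧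
      ∑ᶠ y ∈ wball G w x x (2 * r), (w x y)⁻¹ * μ y ≤ C₀ * r ^ d

theorem IsConductance.nash_of_le (hw : IsConductance G μ w d α) (hconn : G.Connected)
    (hfin : ∀ x, (G.neighborSet x).Finite) {o : V} {κ cμ θ R₀ c₀ C₀ R S r : ℝ}
    (hvol : DVol G μ o d κ cμ θ R₀) (hd : 0 < d) (hα : 0 < α) (hcμ : 1 ≤ cμ) (hc₀ : 0 < c₀)
    (hC₀ : 0 < C₀) (hS : R₀ ≤ S) (hS1 : 1 ≤ S) (hRS : R ≤ S)
    (hmany : HasManyConductances G μ w o d θ c₀ C₀ S) (hr : S ^ θ ≤ r) (hrS : r ≤ S)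
    [Fintype (ball G o R)] (f : ball G o R → ℝ) :
    ∑ i : ball G o R, f i ^ 2 * μ i ≤
      nashConst cμ c₀ C₀ * r ^ α *
        (-∑ i : ball G o R, μ i * f i * ∑ j, dirichletGenerator G μ w d α (ball G o R) i j * f j) +
      nashConst cμ c₀ C₀ * r ^ (-d) * (∑ i : ball G o R, |f i| * μ i) ^ 2 := by
  classical
  have hμ := hvol.pos
  have hSθ : 0 < S ^ θ := by positivity
  have hr0 : 0 < r := lt_of_lt_of_le hSθ hr
  have hcμ0 : 0 < cμ := by linarith
  have hbfin : ∀ x s, (ball G x s).Finite := fun x s => ball_finite G hconn hfin x s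
  have hwfin : ∀ x s, (wball G w x x s).Finite := fun x s =>
    (hbfin x s).subset fun y hy => hy.1
  set F : V → ℝ := fun v => if h : v ∈ ball G o R then f ⟨v, h⟩ else 0 with hF
  have hFf : ∀ i : ball G o R, F i = f i := fun i => by simp [hF]
  have hmem : ∀ v, v ∈ (ball G o R).toFinset ↔ v ∈ ball G o R := fun v => Set.mem_toFinset
  have hin : ∀ v ∈ (ball G o R).toFinset, ∀ s, R ≤ s → v ∈ ball G o s := fun v hv s hs =>
    le_trans ((hmem v).1 hv : (G.dist v o : ℝ) ≤ R) hs
  have key := hw.sum_sq_le hμ (ball G o R).toFinset (fun u => (hwfin u r).toFinset) F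
    (fun v hv => by rw [hmem] at hv; simp [hF, hv]) (r := r) (b := c₀ * cμ⁻¹) (C₀ := C₀) (c := cμ)
    hr0 (by positivity) (by linarith) hconn ?_ ?_ ?_ ?_ ?_
  · rw [← Finset.sum_set_coe (ball G o R), ← Finset.sum_set_coe (ball G o R),
      ← Finset.sum_set_coe (ball G o R)] at key
    have hen : ∀ u : ball G o R, ∑ z ∈ (ball G o R).toFinset, jump G w d α u z * μ z * F z =
        ∑ z : ball G o R, jump G w d α u z * μ z * f z := by
      intro u
      rw [← Finset.sum_set_coe (ball G o R)]
      simp only [hFf]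
    simp only [hFf, hen] at key
    set E := ∑ u : ball G o R, μ u * f u * ((∑' z, jump G w d α u z * μ z) * f u -
      ∑ z : ball G o R, jump G w d α u z * μ z * f z) with hE
    have hE' : -∑ i : ball G o R, μ i * f i * ∑ j, dirichletGenerator G μ w d α (ball G o R) i j * f j = E := by
      rw [hE, ← Finset.sum_neg_distrib]
      refine Finset.sum_congr rfl fun i _ => ?_
      rw [hw.sum_dirichletGenerator]
      ring
    have hE0 : 0 ≤ E := by
      -- Empty windows reduce the energy bound to nonnegativity of `E`.
      have := hw.sum_window_le hμ (ball G o R).toFinset (fun _ => ∅) F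
        (fun v hv => by rw [hmem] at hv; simp [hF, hv])
      rw [← Finset.sum_set_coe (ball G o R), ← Finset.sum_set_coe (ball G o R)] at this
      simp only [hFf, hen, Finset.sum_empty, mul_zero, Finset.sum_const_zero] at this
      linarith
    rw [hE']
    have h1 : 4 * C₀ / (c₀ * cμ⁻¹) ^ 2 ≤ nashConst cμ c₀ C₀ := by
      unfold nashConst
      gcongr
      linarith
    have h2 : 2 * cμ / (c₀ * cμ⁻¹) ^ 2 ≤ nashConst cμ c₀ C₀ := by
      unfold nashConst
      gcongr
      linarith
    calc _ ≤ _ := key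
      _ ≤ _ := by gcongr
  · intro u hu
    have h1 := (hmany r hr hrS u (hin u hu _ (by linarith))).1
    have h2 := (hvol.volume S hS u (hin u hu _ (by linarith)) r (by linarith) (by linarith)).1
    rw [vol.eq_1 μ (wball G w u u r), finsum_mem_eq_finite_toFinset_sum _ (hwfin u r)] at h1
    refine le_trans ?_ h1
    rw [mul_assoc]
    exact mul_le_mul_of_nonneg_left h2 hc₀.le
  · intro u _ z hz
    rw [hw.symm]
    exact ((hwfin u r).mem_toFinset.1 hz).2
  · intro u _ z hz
    rw [G.dist_comm]
    exact ((hwfin u r).mem_toFinset.1 hz).1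
  · intro u hu
    have h1 := (hmany r hr hrS u (hin u hu _ (by linarith))).2
    rw [finsum_mem_eq_finite_toFinset_sum _ (hwfin u (2 * r))] at h1
    refine le_trans (Finset.sum_le_sum_of_subset_of_nonneg (fun z hz => ?_) fun z _ _ =>
      mul_nonneg (inv_nonneg.2 (hw.nonneg u z)) (hμ z).le) h1
    rw [Set.Finite.mem_toFinset] at hz ⊢
    have hz1 : (G.dist z u : ℝ) ≤ r := hz.1
    exact ⟨hz1.trans (by linarith), hz.2⟩
  · intro z hz s _ hs
    refine le_trans (sum_le_vol hμ (hbfin z r) fun u hu => ?_)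
      (hvol.volume S hS z (hin z hz _ (by linarith)) r (by linarith) (by linarith)).2
    have := ((hwfin u r).mem_toFinset.1 (hs u hu)).1
    show (G.dist u z : ℝ) ≤ r
    rw [G.dist_comm]
    exact this

/-- The Nash-type inequality on `B(o, R)` at all scales `r ≥ (K R)^θ`, where `K` is large. -/
theorem IsConductance.nash (hw : IsConductance G μ w d α) (hconn : G.Connected)
    (hfin : ∀ x, (G.neighborSet x).Finite) {o : V} {κ cμ θ R₀ c₀ C₀ R K r : ℝ}
    (hvol : DVol G μ o d κ cμ θ R₀) (hd : 0 < d) (hα : 0 < α) (hcμ : 1 ≤ cμ) (hc₀ : 0 < c₀)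
    (hC₀ : 0 < C₀) (hθ : θ ≤ 1) (hR : R₀ ≤ R) (hR1 : 1 ≤ R) (hK : 1 ≤ K)
    (hK2 : nashConst cμ c₀ C₀ * cμ * K ^ (-d) ≤ 1 / 2)
    (hmany : HasManyConductances G μ w o d θ c₀ C₀ (K * R)) (hr : (K * R) ^ θ ≤ r)
    [Fintype (ball G o R)] (f : ball G o R → ℝ) :
    ∑ i : ball G o R, f i ^ 2 * μ i ≤
      2 * nashConst cμ c₀ C₀ * r ^ α *
        (-∑ i : ball G o R, μ i * f i * ∑ j, dirichletGenerator G μ w d α (ball G o R) i j * f j) +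
      2 * nashConst cμ c₀ C₀ * r ^ (-d) * (∑ i : ball G o R, |f i| * μ i) ^ 2 := by
  have hμ := hvol.pos
  have hA := nashConst_pos hcμ hc₀ hC₀
  set A := nashConst cμ c₀ C₀
  set E := -∑ i : ball G o R, μ i * f i * ∑ j, dirichletGenerator G μ w d α (ball G o R) i j * f j with hE
  set N := ∑ i : ball G o R, |f i| * μ i with hN
  have hRS : R ≤ K * R := by nlinarith
  have hS1 : 1 ≤ K * R := hR1.trans hRS
  have hR0 : 0 < R := by linarith
  have hSθ : 0 < (K * R) ^ θ := by positivity
  have hr0 : 0 < r := lt_of_lt_of_le hSθ hr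
  have hsmall : ∀ r, (K * R) ^ θ ≤ r → r ≤ K * R →
      ∑ i : ball G o R, f i ^ 2 * μ i ≤ A * r ^ α * E + A * r ^ (-d) * N ^ 2 := fun r h1 h2 =>
    hw.nash_of_le hconn hfin hvol hd hα hcμ hc₀ hC₀ (hR.trans hRS) hS1 hRS hmany h1 h2 f
  have hsq : 0 ≤ ∑ i : ball G o R, f i ^ 2 * μ i :=
    Finset.sum_nonneg fun i _ => mul_nonneg (sq_nonneg _) (hμ i).le
  -- The spectral gap: by Cauchy–Schwarz `N²` is at most `cμ R^d ‖f‖₂²`, so `hK2` absorbs the `N²`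
  -- term at scale `K R` into half of the left side.
  have hgap : ∑ i : ball G o R, f i ^ 2 * μ i ≤ 2 * A * (K * R) ^ α * E := by
    have hθ1 : (K * R) ^ θ ≤ K * R := by
      calc (K * R) ^ θ ≤ (K * R) ^ (1 : ℝ) := Real.rpow_le_rpow_of_exponent_le hS1 hθ
        _ = K * R := Real.rpow_one _
    have h1 := hsmall (K * R) hθ1 le_rfl
    have hRθ : R ^ θ ≤ R := by
      calc R ^ θ ≤ R ^ (1 : ℝ) := Real.rpow_le_rpow_of_exponent_le hR1 hθ
        _ = R := Real.rpow_one _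
    have h2 : N ^ 2 ≤ (∑ i : ball G o R, f i ^ 2 * μ i) * ∑ i : ball G o R, μ i :=
      Finset.sum_sq_le_sum_mul_sum_of_sq_le_mul _
        (fun i _ => mul_nonneg (sq_nonneg _) (hμ i).le) (fun i _ => (hμ i).le)
        fun i _ => by rw [mul_pow, sq_abs]; exact le_of_eq (by ring)
    have h3 : ∑ i : ball G o R, μ i ≤ cμ * R ^ d := by
      rw [Finset.sum_set_coe (ball G o R)]
      refine (sum_le_vol hμ (ball_finite G hconn hfin o R) fun x hx => Set.mem_toFinset.1 hx).trans
        (hvol.volume R hR o ?_ R (by linarith) (by linarith)).2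
      show (G.dist o o : ℝ) ≤ 6 * R
      rw [SimpleGraph.dist_self]
      simp only [Nat.cast_zero]
      positivity
    have h4 : A * (K * R) ^ (-d) * N ^ 2 ≤ 1 / 2 * ∑ i : ball G o R, f i ^ 2 * μ i := by
      calc A * (K * R) ^ (-d) * N ^ 2
          ≤ A * (K * R) ^ (-d) * ((∑ i : ball G o R, f i ^ 2 * μ i) * (cμ * R ^ d)) := by
            have : 0 ≤ A * (K * R) ^ (-d) := by positivity
            exact mul_le_mul_of_nonneg_left
              (h2.trans (mul_le_mul_of_nonneg_left h3 hsq)) this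
        _ = (A * cμ * K ^ (-d)) * (R ^ (-d) * R ^ d) * ∑ i : ball G o R, f i ^ 2 * μ i := by
            rw [Real.mul_rpow (by linarith) hR0.le]; ring
        _ = (A * cμ * K ^ (-d)) * ∑ i : ball G o R, f i ^ 2 * μ i := by
            rw [← Real.rpow_add hR0, neg_add_cancel, Real.rpow_zero, mul_one]
        _ ≤ _ := mul_le_mul_of_nonneg_right hK2 hsq
    linarith
  have hN2 : 0 ≤ A * r ^ (-d) * N ^ 2 := by positivity
  rcases le_total r (K * R) with h | h
  · have h1 := hsmall r hr h
    have hE0 : 0 ≤ A * r ^ α * E := by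
      have : 0 < 2 * A * (K * R) ^ α := by positivity
      have hE0 : 0 ≤ E := nonneg_of_mul_nonneg_right (hsq.trans hgap) this
      positivity
    linarith
  -- Beyond `K R` the gap alone suffices, since `r^α` only grows.
  · have : 0 < 2 * A * (K * R) ^ α := by positivity
    have hE0 : 0 ≤ E := nonneg_of_mul_nonneg_right (hsq.trans hgap) this
    have h1 : 2 * A * (K * R) ^ α * E ≤ 2 * A * r ^ α * E := by gcongr
    linarith

end Nash

/-! ### Chernoff approximation of the semigroup. -/

/-- Telescoping: `aⁿ - bⁿ` is a sum of `n` products, each with one factor `a - b` among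
contractions. -/
theorem norm_pow_sub_pow_le_of_norm_le_one {R : Type*} [NormedRing R] {a b : R} (ha : ‖a‖ ≤ 1)
    (hb : ‖b‖ ≤ 1) (n : ℕ) : ‖a ^ n - b ^ n‖ ≤ n * ‖a - b‖ := by
  -- Stated with a factor `c` because `‖1‖ ≤ 1` may fail in a normed ring.
  have hmul : ∀ (n : ℕ) (c : R), ‖a ^ n * c‖ ≤ ‖c‖ := by
    intro n
    induction n with
    | zero => intro c; simp
    | succ n ih =>
      intro c
      rw [pow_succ, mul_assoc]
      calc _ ≤ ‖a * c‖ := ih _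
        _ ≤ ‖a‖ * ‖c‖ := norm_mul_le _ _
        _ ≤ 1 * ‖c‖ := by gcongr
        _ = ‖c‖ := one_mul _
  induction n with
  | zero => simp
  | succ n ih =>
    have h1 : a ^ (n + 1) - b ^ (n + 1) = a ^ n * (a - b) + (a ^ n - b ^ n) * b := by
      rw [pow_succ, pow_succ]; noncomm_ring
    rw [h1]
    calc _ ≤ ‖a ^ n * (a - b)‖ + ‖(a ^ n - b ^ n) * b‖ := norm_add_le _ _
      _ ≤ ‖a - b‖ + ‖a ^ n - b ^ n‖ * 1 := by
        gcongr
        · exact hmul _ _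
        · exact (norm_mul_le _ _).trans (by gcongr)
      _ ≤ ‖a - b‖ + n * ‖a - b‖ * 1 := by gcongr
      _ = _ := by push_cast; ring

section MatrixSemigroup

variable {ι : Type*} [Fintype ι] [DecidableEq ι]

open scoped Matrix.Norms.Operator in
theorem norm_le_one_of_row_sum_le {a : Matrix ι ι ℝ} (ha : ∀ i j, 0 ≤ a i j)
    (hrow : ∀ i, ∑ j, a i j ≤ 1) : ‖a‖ ≤ 1 := by
  rw [Matrix.linfty_opNorm_def, ← NNReal.coe_one, NNReal.coe_le_coe]
  refine Finset.sup_le fun i _ => ?_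
  rw [← NNReal.coe_le_coe]
  push_cast
  refine le_trans (le_of_eq ?_) (hrow i)
  exact Finset.sum_congr rfl fun j _ => by rw [Real.norm_of_nonneg (ha i j)]

open scoped Matrix.Norms.Operator in
theorem tendsto_matrix_pow_sub_pow {a b : ℕ → Matrix ι ι ℝ} (ha : ∀ n i j, 0 ≤ a n i j)
    (ha1 : ∀ n i, ∑ j, a n i j ≤ 1) (hb : ∀ n i j, 0 ≤ b n i j) (hb1 : ∀ n i, ∑ j, b n i j ≤ 1)
    (hab : ∀ i j, Tendsto (fun n : ℕ => (n : ℝ) * (a n i j - b n i j)) atTop (𝓝 0)) (i j : ι) :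
    Tendsto (fun n : ℕ => (a n ^ n) i j - (b n ^ n) i j) atTop (𝓝 0) := by
  have h1 : Tendsto (fun n : ℕ => (n : ℝ) • (a n - b n)) atTop (𝓝 0) :=
    tendsto_pi_nhds.2 fun i => tendsto_pi_nhds.2 fun j => hab i j
  have h2 : Tendsto (fun n : ℕ => a n ^ n - b n ^ n) atTop (𝓝 0) := by
    refine squeeze_zero_norm (fun n => ?_) (tendsto_norm_zero.comp h1)
    rw [Function.comp_apply, norm_smul, Real.norm_natCast]
    exact norm_pow_sub_pow_le_of_norm_le_one (norm_le_one_of_row_sum_le (ha n) (ha1 n))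
      (norm_le_one_of_row_sum_le (hb n) (hb1 n)) n
  exact tendsto_pi_nhds.1 (tendsto_pi_nhds.1 h2 i) j

/-- Chernoff's product formula for sub-Markovian matrices. -/
theorem IsSubMarkovGenerator.tendsto_pow {m : ι → ℝ} {L : Matrix ι ι ℝ}
    (h : IsSubMarkovGenerator m L) {T : ℝ≥0 → Matrix ι ι ℝ} (hT : ∀ s i j, 0 ≤ T s i j)
    (hT1 : ∀ s i, ∑ j, T s i j ≤ 1)
    (hlim : ∀ i j, Tendsto (fun s : ℝ≥0 => (s : ℝ)⁻¹ * (T s i j - (1 : Matrix ι ι ℝ) i j))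
      (𝓝[>] 0) (𝓝 (L i j))) {t : ℝ≥0} (ht : 0 < t) (i j : ι) :
    Tendsto (fun n : ℕ => (T (t / n) ^ n) i j) atTop (𝓝 (NormedSpace.exp ((t : ℝ) • L) i j)) := by
  have hcoe : Tendsto (fun s : ℝ≥0 => (s : ℝ)) (𝓝[>] 0) (𝓝[≠] 0) := by
    refine tendsto_nhdsWithin_iff.2 ⟨?_, ?_⟩
    · exact (NNReal.continuous_coe.tendsto 0).mono_left nhdsWithin_le_nhds
    · filter_upwards [self_mem_nhdsWithin] with s hs
      have hs' : (0 : ℝ≥0) < s := hs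
      simpa using hs'.ne'
  have hstep : Tendsto (fun n : ℕ => t / (n : ℝ≥0)) atTop (𝓝[>] 0) := by
    refine tendsto_nhdsWithin_iff.2 ⟨?_, ?_⟩
    · exact tendsto_const_div_atTop_nhds_zero_nat t
    · filter_upwards [eventually_gt_atTop 0] with n hn
      exact div_pos ht (by exact_mod_cast hn)
  have hexp : ∀ i j, Tendsto (fun s : ℝ≥0 => (s : ℝ)⁻¹ *
      (NormedSpace.exp ((s : ℝ) • L) i j - (1 : Matrix ι ι ℝ) i j)) (𝓝[>] 0) (𝓝 (L i j)) := by
    intro i j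
    have h1 := (hasDerivAt_matrix_exp_apply L 0 i j).tendsto_slope_zero.comp hcoe
    simpa [Function.comp_def] using h1
  -- `T s` and `exp (s • L)` have the same derivative at 0, so they differ by `o(1/n)` at `s = t/n`;
  -- the `n`-th power of the latter is exactly `exp (t • L)`.
  have key := tendsto_matrix_pow_sub_pow (a := fun n => T (t / n))
    (b := fun n => NormedSpace.exp (((t / n : ℝ≥0) : ℝ) • L)) (fun n => hT _) (fun n => hT1 _)
    (fun n => h.exp_nonneg (NNReal.coe_nonneg _)) (fun n => h.exp_row (NNReal.coe_nonneg _))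
    (fun i j => by
      have h1 := (((hlim i j).sub (hexp i j)).comp hstep).const_mul (t : ℝ)
      rw [sub_self, mul_zero] at h1
      refine h1.congr' ?_
      filter_upwards [eventually_gt_atTop 0] with n hn
      have hn' : (n : ℝ) ≠ 0 := by exact_mod_cast hn.ne'
      have ht' : (t : ℝ) ≠ 0 := by exact_mod_cast ht.ne'
      simp only [Function.comp_apply, NNReal.coe_div, NNReal.coe_natCast]
      field_simp
      ring) i j
  have hpow : ∀ᶠ n : ℕ in atTop, (NormedSpace.exp (((t / n : ℝ≥0) : ℝ) • L) ^ n) i j =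
      NormedSpace.exp ((t : ℝ) • L) i j := by
    filter_upwards [eventually_gt_atTop 0] with n hn
    have hn' : (n : ℝ) ≠ 0 := by exact_mod_cast hn.ne'
    rw [← Matrix.exp_nsmul, ← Nat.cast_smul_eq_nsmul ℝ, smul_smul, NNReal.coe_div,
      NNReal.coe_natCast, mul_div_cancel₀ _ hn']
  have h2 := (key.congr' (hpow.mono fun n hn => by rw [hn])).add_const
    (NormedSpace.exp ((t : ℝ) • L) i j)
  simpa using h2

end MatrixSemigroup

/-! ### The associated process: infinitesimal transition rates and killing. -/

section DirichletForm

variable {V : Type*} {G : SimpleGraph V} {μ : V → ℝ} {w : V → V → ℝ} {d α : ℝ}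

/-- The Dirichlet form of a finitely supported function. -/
theorem IsConductance.hasSum_energyDensity (hw : IsConductance G μ w d α) (hμ : ∀ x, 0 < μ x)
    (s : Finset V) (f : V → ℝ) (hf : ∀ v, v ∉ s → f v = 0) :
    HasSum (energyDensity G μ w d α f)
      (2 * ∑ u ∈ s, μ u * f u * ((∑' z, jump G w d α u z * μ z) * f u -
        ∑ z ∈ s, jump G w d α u z * μ z * f z)) := by
  classical
  -- The density splits as `g + g ∘ swap` minus twice a cross term; finite support of `f` makes each
  -- piece summable separately.
  set g : V × V → ℝ := fun p => f p.1 ^ 2 * μ p.1 * (jump G w d α p.1 p.2 * μ p.2) with hg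
  have hg0 : 0 ≤ g := fun p => mul_nonneg (mul_nonneg (sq_nonneg _) (hμ _).le)
    (mul_nonneg (hw.jump_nonneg _ _) (hμ _).le)
  have hgin : ∀ u, ∑' z, g (u, z) = f u ^ 2 * μ u * ∑' z, jump G w d α u z * μ z := fun u => by
    simp only [hg]
    exact tsum_mul_left
  have hsum : Summable g := by
    rw [summable_prod_of_nonneg hg0]
    refine ⟨fun u => ?_, ?_⟩
    · simp only [hg]
      exact (hw.summable u).mul_left (f u ^ 2 * μ u)
    refine summable_of_ne_finset_zero (s := s) fun u hu => ?_
    rw [hgin, hf u hu]; ring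
  have hgval : HasSum g (∑ u ∈ s, f u ^ 2 * μ u * ∑' z, jump G w d α u z * μ z) := by
    have h1 := hsum.hasSum
    rw [hsum.tsum_prod] at h1
    rw [tsum_eq_sum (s := s) fun u hu => by rw [hgin, hf u hu]; ring] at h1
    simpa only [hgin] using h1
  have hgswap : HasSum (g ∘ Prod.swap)
      (∑ u ∈ s, f u ^ 2 * μ u * ∑' z, jump G w d α u z * μ z) :=
    (Equiv.prodComm V V).hasSum_iff.2 hgval
  have hcross : HasSum (fun p : V × V => f p.1 * f p.2 * (jump G w d α p.1 p.2 * μ p.1 * μ p.2))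
      (∑ p ∈ s ×ˢ s, f p.1 * f p.2 * (jump G w d α p.1 p.2 * μ p.1 * μ p.2)) := by
    refine hasSum_sum_of_ne_finset_zero fun p hp => ?_
    rw [Finset.mem_product, not_and_or] at hp
    rcases hp with hp | hp <;> rw [hf _ hp] <;> ring
  have h := (hgval.add hgswap).sub (hcross.mul_left 2)
  have hfun : energyDensity G μ w d α f = fun p => g p + (g ∘ Prod.swap) p -
      2 * (f p.1 * f p.2 * (jump G w d α p.1 p.2 * μ p.1 * μ p.2)) := by
    funext p
    simp only [energyDensity, hg, Function.comp_apply, Prod.fst_swap, Prod.snd_swap]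
    rw [hw.jump_symm p.2 p.1]
    ring
  rw [hfun]
  refine (congrArg (fun c => HasSum _ c) ?_).mpr h
  rw [Finset.sum_product, ← two_mul, ← mul_sub, ← Finset.sum_sub_distrib]
  congr 1
  refine Finset.sum_congr rfl fun u _ => ?_
  have : ∑ z ∈ s, f u * f z * (jump G w d α u z * μ u * μ z) =
      μ u * f u * ∑ z ∈ s, jump G w d α u z * μ z * f z := by
    rw [Finset.mul_sum]
    exact Finset.sum_congr rfl fun z _ => by ring
  simp only [this]
  ring

namespace MarkovProcess

variable {Ω : Type*} [MeasurableSpace Ω] {M : MarkovProcess V Ω}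

theorem approxForm_eq_sum (s : Finset V) (f : V → ℝ) (hf : ∀ v, v ∉ s → f v = 0) (t : ℝ≥0) :
    M.approxForm μ f t =
      (t : ℝ)⁻¹ * ∑ x ∈ s, (f x - ∑ y ∈ s, M.trans t x y * f y) * f x * μ x := by
  rw [approxForm, tsum_eq_sum (s := s) fun x hx => by rw [hf x hx]; ring]
  have : ∀ x, M.semigroup t f x = ∑ y ∈ s, M.trans t x y * f y := fun x =>
    tsum_eq_sum fun y hy => by rw [hf y hy, mul_zero]
  simp only [this]

theorem IsAssociated.tendsto_approxForm (hM : M.IsAssociated G μ w d α)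
    (hw : IsConductance G μ w d α) (hμ : ∀ x, 0 < μ x) (s : Finset V) (f : V → ℝ)
    (hf : ∀ v, v ∉ s → f v = 0) :
    Tendsto (fun t : ℝ≥0 =>
      (t : ℝ)⁻¹ * ∑ x ∈ s, (f x - ∑ y ∈ s, M.trans t x y * f y) * f x * μ x) (𝓝[>] 0)
      (𝓝 (∑ u ∈ s, μ u * f u * ((∑' z, jump G w d α u z * μ z) * f u -
        ∑ z ∈ s, jump G w d α u z * μ z * f z))) := by
  have h1 := hw.hasSum_energyDensity hμ s f hf
  have h2 : MemDomain G μ w d α f :=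
    ⟨summable_of_ne_finset_zero (s := s) fun x hx => by rw [hf x hx]; ring, h1.summable⟩
  have h3 := hM.tendsto f h2
  rw [energy, h1.tsum_eq, ← mul_assoc, one_div_mul_cancel two_ne_zero, one_mul] at h3
  exact h3.congr fun t => approxForm_eq_sum s f hf t

open Classical in
/-- The transition function of a process associated with the form is differentiable at `0`, with
the matrix of the generator as derivative. -/
theorem IsAssociated.tendsto_trans (hM : M.IsAssociated G μ w d α)
    (hw : IsConductance G μ w d α) (hμ : ∀ x, 0 < μ x) (x y : V) :
    Tendsto (fun t : ℝ≥0 => (t : ℝ)⁻¹ * (M.trans t x y - if x = y then 1 else 0)) (𝓝[>] 0)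
      (𝓝 (jump G w d α x y * μ y - if x = y then ∑' z, jump G w d α x z * μ z else 0)) := by
  have hdiag : ∀ x, Tendsto (fun t : ℝ≥0 => (t : ℝ)⁻¹ * ((1 - M.trans t x x) * μ x)) (𝓝[>] 0)
      (𝓝 (μ x * ∑' z, jump G w d α x z * μ z)) := by
    intro x
    have h1 := hM.tendsto_approxForm hw hμ {x} (Pi.single x 1)
      fun v hv => Pi.single_eq_of_ne (by simpa using hv) _
    simpa [hw.jump_self] using h1
  by_cases hxy : x = y
  · subst hxy
    have h1 := (hdiag x).mul_const (-(μ x)⁻¹)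
    have hx := (hμ x).ne'
    simp only [if_true]
    rw [hw.jump_self]
    convert h1 using 1
    · funext t; field_simp; ring
    · congr 1; field_simp; ring
  · have hyx : y ≠ x := Ne.symm hxy
    -- Polarization: the forms at the indicators of `x` and of `y`, minus the form at their sum,
    -- leave two cross terms. They are equal by symmetry, whence the factor `(2 μ_x)⁻¹`.
    have h1 := hM.tendsto_approxForm hw hμ {x, y} (Pi.single x 1 + Pi.single y 1) fun v hv => by
      simp only [Finset.mem_insert, Finset.mem_singleton, not_or] at hv
      simp [hv.1, hv.2]
    simp only [Finset.sum_pair hxy, Pi.add_apply, Pi.single_eq_same, Pi.single_eq_of_ne hxy,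
      Pi.single_eq_of_ne hyx, hw.jump_self, hw.jump_symm y x] at h1
    have h2 := (((hdiag x).add (hdiag y)).sub h1).mul_const ((2 * μ x)⁻¹)
    have hx := (hμ x).ne'
    simp only [if_neg hxy]
    convert h2 using 1
    · funext t
      have h3 := hM.symm t x y
      have h4 : M.trans t y x = μ x * M.trans t x y / μ y := by
        rw [h3]; have := (hμ y).ne'; field_simp
      rw [h4]
      have := (hμ y).ne'
      field_simp
      ring
    · congr 1; field_simp; ring

theorem trans_nonneg (M : MarkovProcess V Ω) (t : ℝ≥0) (x y : V) : 0 ≤ M.trans t x y :=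
  measureReal_nonneg

theorem measurableSet_eq (M : MarkovProcess V Ω) (t : ℝ≥0) (o : Option V) :
    MeasurableSet {ω | M.X t ω = o} :=
  show MeasurableSet (M.X t ⁻¹' {o}) from M.measurable t trivial

theorem sum_trans_le_one (M : MarkovProcess V Ω) (t : ℝ≥0) (x : V) (s : Finset V) :
    ∑ y ∈ s, M.trans t x y ≤ 1 := by
  have := M.isProbabilityMeasure x
  unfold trans
  rw [← measureReal_biUnion_finset]
  · exact measureReal_le_one
  · intro y _ z _ hyz
    refine Set.disjoint_left.2 fun ω (hω : _ = _) (hω' : _ = _) => hyz ?_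
    exact Option.some.inj (hω.symm.trans hω')
  · exact fun y _ => M.measurableSet_eq t _

/-- The skeleton of the process at the times `0, h, …, n h` stays in `A` and ends at `y` with at most
the probability given by the power of the transition matrix restricted to `A`. -/
theorem skeleton_le (M : MarkovProcess V Ω) {A : Set V} [Fintype A] [DecidableEq A] (h : ℝ≥0)
    (x : A) (n : ℕ) (y : A) :
    (M.P x).real ({ω | ∀ i ≤ n, ∃ a ∈ A, M.X (i * h) ω = some a} ∩
        {ω | M.X (n * h) ω = some (y : V)}) ≤
      ((Matrix.of fun a b : A => M.trans h a b) ^ n) x y := by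
  have := M.isProbabilityMeasure x
  induction n generalizing y with
  | zero =>
    rw [pow_zero, Matrix.one_apply]
    split_ifs with hxy
    · exact measureReal_le_one
    · rw [measureReal_def, measure_eq_zero_iff_ae_notMem.2, ENNReal.toReal_zero]
      filter_upwards [M.start x] with ω hω hmem
      have h1 : M.X (((0 : ℕ) : ℝ≥0) * h) ω = some (y : V) := hmem.2
      rw [Nat.cast_zero, zero_mul, hω] at h1
      exact hxy (Subtype.ext (Option.some.inj h1))
  | succ n ih =>
    rw [pow_succ, Matrix.mul_apply]
    set E : Set Ω := {ω | ∀ i ≤ n, ∃ a ∈ A, M.X (i * h) ω = some a} with hE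
    -- Decompose by the position `z` at time `n h`, where the Markov property is applied.
    have hsub : {ω | ∀ i ≤ n + 1, ∃ a ∈ A, M.X (i * h) ω = some a} ∩
        {ω | M.X ((n + 1 : ℕ) * h) ω = some (y : V)} ⊆
        ⋃ z ∈ (Finset.univ : Finset A), E ∩ {ω | M.X (n * h) ω = some (z : V)} ∩
          {ω | M.X (n * h + h) ω = some (y : V)} := by
      rintro ω ⟨h1, h2⟩
      obtain ⟨a, ha, haω⟩ := h1 n (Nat.le_succ n)
      refine Set.mem_biUnion (x := (⟨a, ha⟩ : A)) (Finset.mem_univ _)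
        ⟨⟨fun i hi => h1 i (hi.trans (Nat.le_succ n)), haω⟩, ?_⟩
      have h3 : M.X ((n + 1 : ℕ) * h) ω = some (y : V) := h2
      rwa [Nat.cast_succ, add_mul, one_mul] at h3
    have hmeas : MeasurableSet[⨆ u : Set.Iic ((n : ℝ≥0) * h), MeasurableSpace.comap (M.X u) ⊤] E := by
      have : E = ⋂ i ∈ Set.Iic n, {ω | ∃ a ∈ A, M.X (i * h) ω = some a} := by
        ext ω; simp [hE]
      rw [this]
      refine MeasurableSet.biInter (Set.to_countable _) fun i hi => ?_
      have hle : (i : ℝ≥0) * h ≤ n * h := by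
        have : (i : ℝ≥0) ≤ n := by exact_mod_cast hi
        gcongr
      exact (le_iSup (fun u : Set.Iic ((n : ℝ≥0) * h) => MeasurableSpace.comap (M.X u) ⊤)
        ⟨_, hle⟩) _ ⟨{o | ∃ a ∈ A, o = some a}, trivial, rfl⟩
    refine (measureReal_mono hsub (measure_ne_top _ _)).trans ((measureReal_biUnion_finset_le _ _).trans ?_)
    refine Finset.sum_le_sum fun z _ => ?_
    rw [measureReal_def, M.markov x (n * h) h E hmeas z y, ENNReal.toReal_mul]
    exact mul_le_mul_of_nonneg_right (ih z) ENNReal.toReal_nonneg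

/-- Before `τ_A` the path lies in `A` at every time in `(0, t]`, in particular on the grid of mesh
`t/n`. Time 0 escapes the definition of `τ_A` and is covered by the almost sure starting point. -/
theorem killed_le_pow (M : MarkovProcess V Ω) {A : Set V} [Fintype A] [DecidableEq A] {t : ℝ≥0}
    (ht : 0 < t) (x y : A) {n : ℕ} (hn : 0 < n) :
    (M.P x).real {ω | M.X t ω = some (y : V) ∧ (t : ℝ≥0∞) < M.exitTime A ω} ≤
      ((Matrix.of fun a b : A => M.trans (t / n) a b) ^ n) x y := by
  have := M.isProbabilityMeasure x
  refine le_trans ?_ (M.skeleton_le (t / n) x n y)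
  have hn' : (0 : ℝ≥0) < n := by exact_mod_cast hn
  refine ENNReal.toReal_mono (measure_ne_top _ _) (measure_mono_ae ?_)
  filter_upwards [M.start x] with ω hω hmem
  have h1 : M.X t ω = some (y : V) := hmem.1
  have h2 : (t : ℝ≥0∞) < M.exitTime A ω := hmem.2
  have hstay : ∀ s : ℝ≥0, 0 < s → s ≤ t → ∃ a ∈ A, M.X s ω = some a := by
    intro s hs hst
    by_contra hcon
    push Not at hcon
    have h3 : M.exitTime A ω ≤ s :=
      iInf_le (fun s : {s : ℝ≥0 // 0 < s ∧ ∀ v ∈ A, M.X s ω ≠ some v} => ((s : ℝ≥0) : ℝ≥0∞))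
        ⟨s, hs, hcon⟩
    exact absurd (h2.trans_le h3) (not_lt.2 (by exact_mod_cast hst))
  refine ⟨fun i hi => ?_, ?_⟩
  · rcases Nat.eq_zero_or_pos i with rfl | hi0
    · exact ⟨x, x.2, by rw [Nat.cast_zero, zero_mul, hω]⟩
    · have hi' : (0 : ℝ≥0) < i := by exact_mod_cast hi0
      refine hstay _ (by positivity) ?_
      calc (i : ℝ≥0) * (t / n) ≤ n * (t / n) := by
            have : (i : ℝ≥0) ≤ n := by exact_mod_cast hi
            gcongr
        _ = t := mul_div_cancel₀ _ hn'.ne'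
  · show M.X (n * (t / n)) ω = some (y : V)
    rwa [mul_div_cancel₀ _ hn'.ne']

/-- The process killed on exiting a finite set `A` has a smaller transition density than the
Dirichlet heat kernel of `A`. -/
theorem IsAssociated.killedHeatKernel_le (hM : M.IsAssociated G μ w d α)
    (hw : IsConductance G μ w d α) (hμ : ∀ x, 0 < μ x) {A : Set V} (hA : A.Finite) {t : ℝ≥0}
    (ht : 0 < t) {x y : V} (hx : x ∈ A) (hy : y ∈ A) :
    M.killedHeatKernel μ A t x y ≤ dirichletHeatKernel G μ w d α A t x y := by
  classical
  let : Fintype A := hA.fintype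
  have hgen := hw.isSubMarkovGenerator hμ (A := A)
  have hlim := hgen.tendsto_pow (T := fun s => Matrix.of fun a b : A => M.trans s a b)
    (fun s a b => M.trans_nonneg s a b)
    (fun s a => by
      have := M.sum_trans_le_one s a A.toFinset
      rwa [← Finset.sum_set_coe A] at this)
    (fun a b => by
      have := hM.tendsto_trans hw hμ a b
      rw [hw.dirichletGenerator_apply]
      simpa only [Matrix.of_apply, Matrix.one_apply, Subtype.ext_iff] using this)
    ht ⟨x, hx⟩ ⟨y, hy⟩
  rw [killedHeatKernel, dirichletHeatKernel, dif_pos ⟨hA, hx, hy⟩]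
  have := (hμ y).le
  refine div_le_div_of_nonneg_right (ge_of_tendsto hlim ?_) this
  filter_upwards [eventually_gt_atTop 0] with n hn
  exact M.killed_le_pow ht ⟨x, hx⟩ ⟨y, hy⟩ hn

end MarkovProcess

end DirichletForm

/-! ### The threshold on `R` and the conclusion. -/

/-- The initial phase ends in time. The exponent is `-c R^((θ'-θ)α)` with `c = 1/(4 A K^(θα))`, and
since `θ < θ'` it beats the power `R^(κ+θd)` left after moving the right side over. -/
theorem eventually_rpow_mul_exp_le {A K κ θ θ' α d : ℝ} (hA : 0 < A) (hK : 0 < K) (hα : 0 < α)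
    (hθθ' : θ < θ') :
    ∀ᶠ R : ℝ in atTop, R ^ κ * Real.exp (-(R ^ (θ' * α) / 2 / (2 * (A * ((K * R) ^ θ) ^ α)))) ≤
      2 * A * ((K * R) ^ θ) ^ (-d) := by
  have hε : 0 < (θ' - θ) * α := mul_pos (by linarith) hα
  have hb : 0 < 1 / (4 * A * K ^ (θ * α)) := by positivity
  have hlim := (tendsto_rpow_mul_exp_neg_mul_atTop_nhds_zero ((κ + θ * d) / ((θ' - θ) * α)) _
    hb).comp (tendsto_rpow_atTop hε)
  have hpos : 0 < 2 * A * K ^ (-(θ * d)) := by positivity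
  filter_upwards [hlim.eventually_lt_const hpos, eventually_gt_atTop 0] with R hR hR0
  simp only [Function.comp_apply] at hR
  rw [← Real.rpow_mul hR0.le, mul_div_cancel₀ _ hε.ne', Real.rpow_add hR0] at hR
  have h1 : ((K * R) ^ θ) ^ α = K ^ (θ * α) * R ^ (θ * α) := by
    rw [← Real.rpow_mul (by positivity), Real.mul_rpow hK.le hR0.le]
  have h2 : ((K * R) ^ θ) ^ (-d) = K ^ (-(θ * d)) * (R ^ (θ * d))⁻¹ := by
    rw [← Real.rpow_mul (by positivity), Real.mul_rpow hK.le hR0.le, mul_neg,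
      Real.rpow_neg hR0.le]
  have h3 : R ^ (θ' * α) / 2 / (2 * (A * (K ^ (θ * α) * R ^ (θ * α)))) =
      1 / (4 * A * K ^ (θ * α)) * R ^ ((θ' - θ) * α) := by
    rw [sub_mul, Real.rpow_sub hR0]
    field_simp
    ring
  rw [h1, h2, h3, ← neg_mul, ← mul_assoc, ← div_eq_mul_inv, le_div_iff₀ (by positivity)]
  refine le_trans (le_of_eq ?_) hR.le
  ring

end Conductance

theorem mainTheorem10
    (d α cμ κ θ c₀ C₀ θ' : ℝ) (hd : 0 < d) (hα : 0 < α) (hα2 : α < 2) (hcμ : 1 ≤ cμ)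
    (hκ : 0 < κ) (hθ : 0 < θ) (hθ1 : θ < 1) (hc₀ : 1 / 2 < c₀) (hC₀ : 0 < C₀)
    (hθθ' : θ < θ') (hθ'1 : θ' < 1) :
    ∃ C₁ : ℝ, 0 < C₁ ∧
      ∀ (V : Type*) [Infinite V] (G : SimpleGraph V) (μ : V → ℝ) (w : V → V → ℝ) (o : V)
        (R₀ R₀' : ℝ),
        G.Connected → (∀ x, (G.neighborSet x).Finite) →
        1 ≤ R₀ → 1 ≤ R₀' →
        Conductance.IsConductance G μ w d α →
        Conductance.DVol G μ o d κ cμ θ R₀ →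
        (∀ R : ℝ, R₀' ≤ R → ∀ r : ℝ, R ^ θ ≤ r → r ≤ R →
          (∀ x ∈ Conductance.ball G o (2 * R), ∀ z ∈ Conductance.ball G o (2 * R),
            c₀ * Conductance.vol μ (Conductance.ball G x r) ≤
              Conductance.vol μ (Conductance.wball G w z x r)) ∧
          (∀ x ∈ Conductance.ball G o (2 * R),
            ∑ᶠ y ∈ Conductance.wball G w x x (2 * r), (w x y)⁻¹ * μ y ≤ C₀ * r ^ d)) →
        ∃ R₁ : ℝ, 1 ≤ R₁ ∧
          ∀ R : ℝ, R₁ < R →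
            ∀ x₁ ∈ Conductance.ball G o R, ∀ x₂ ∈ Conductance.ball G o R,
              ∀ t : ℝ≥0, R ^ (θ' * α) ≤ (t : ℝ) →
                Conductance.dirichletHeatKernel G μ w d α (Conductance.ball G o R) t x₁ x₂ ≤
                    C₁ * (t : ℝ) ^ (-(d / α)) ∧
                ∀ (Ω : Type*) [MeasurableSpace Ω] (M : Conductance.MarkovProcess V Ω),
                  M.IsAssociated G μ w d α →
                  M.killedHeatKernel μ (Conductance.ball G o R) t x₁ x₂ ≤
                    C₁ * (t : ℝ) ^ (-(d / α)) := by
  have hc₀' : 0 < c₀ := by linarith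
  have hcμ0 : 0 < cμ := by linarith
  have hA₀ := Conductance.nashConst_pos hcμ hc₀' hC₀
  set A₀ := Conductance.nashConst cμ c₀ C₀ with hA₀def
  -- Chosen so that `A₀ cμ K^(-d) ≤ 1/2`, the absorption needed for the spectral gap.
  set K := max 1 ((2 * A₀ * cμ) ^ (1 / d)) with hKdef
  have hK1 : 1 ≤ K := le_max_left _ _
  have hK0 : 0 < K := by linarith
  have hK2 : A₀ * cμ * K ^ (-d) ≤ 1 / 2 := by
    have h1 : 2 * A₀ * cμ ≤ K ^ d := by
      calc 2 * A₀ * cμ = ((2 * A₀ * cμ) ^ (1 / d)) ^ d := by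
            rw [← Real.rpow_mul (by positivity), one_div_mul_cancel hd.ne', Real.rpow_one]
        _ ≤ _ := Real.rpow_le_rpow (by positivity) (le_max_right _ _) hd.le
    rw [Real.rpow_neg hK0.le, ← div_eq_mul_inv, div_le_iff₀ (by positivity)]
    linarith
  set b := α / d / (2 * A₀ * (2 * (2 * A₀)) ^ (α / d)) with hb
  have hb0 : 0 < b := by positivity
  -- `p(t,x,x) = u(t/2)`, and the decay is integrated over half of `[0, t/2]`: two factors `1/2`.
  refine ⟨(b / 4) ^ (-(d / α)), by positivity, ?_⟩
  intro V _ G μ w o R₀ R₀' hconn hfin hR₀ hR₀' hw hvol hcond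
  obtain ⟨R₂, hR₂⟩ := eventually_atTop.1 (Conductance.eventually_rpow_mul_exp_le (κ := κ) (d := d)
    (by positivity : 0 < 2 * A₀) hK0 hα hθθ')
  refine ⟨max 1 (max R₀ (max R₀' R₂)), le_max_left _ _, ?_⟩
  intro R hR x₁ hx₁ x₂ hx₂ t ht
  simp only [max_lt_iff] at hR
  obtain ⟨hR1, hRR₀, hRR₀', hRR₂⟩ := hR
  have hR0 : 0 < R := by linarith
  have hRS : R ≤ K * R := by nlinarith
  have ht0 : 0 < (t : ℝ) := lt_of_lt_of_le (by positivity) ht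
  have hmain : Conductance.dirichletHeatKernel G μ w d α (Conductance.ball G o R) t x₁ x₂ ≤
      (b / 4) ^ (-(d / α)) * (t : ℝ) ^ (-(d / α)) := by
    classical
    have hbf := Conductance.ball_finite G hconn hfin o R
    have hmany : Conductance.HasManyConductances G μ w o d θ c₀ C₀ (K * R) := by
      intro r hr1 hr2 x hx
      have h1 := hcond (K * R) (hRR₀'.le.trans hRS) r hr1 hr2
      exact ⟨h1.1 x hx x hx, h1.2 x hx⟩
    rw [Conductance.dirichletHeatKernel, dif_pos ⟨hbf, hx₁, hx₂⟩]
    let : Fintype (Conductance.ball G o R) := hbf.fintype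
    have hgen := hw.isSubMarkovGenerator hvol.pos (A := Conductance.ball G o R)
    have hdiag : ∀ x : Conductance.ball G o R,
        NormedSpace.exp (((t : ℝ) / 2 + (t : ℝ) / 2) •
          Conductance.dirichletGenerator G μ w d α (Conductance.ball G o R)) x x / μ x ≤
        (b / 4) ^ (-(d / α)) * (t : ℝ) ^ (-(d / α)) := by
      intro x
      refine (hgen.exp_diag_le (A := 2 * A₀) (r₀ := (K * R) ^ θ) (α := α) (d := d)
        (by positivity) (by positivity) hα hd (by positivity)
        (fun r hr f => hw.nash hconn hfin hvol hd hα hcμ hc₀' hC₀ hθ1.le hRR₀.le hR1.le hK1 hK2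
          hmany hr f) x ?_).trans (le_of_eq ?_)
      · refine le_trans ?_ (hR₂ R hRR₂.le)
        -- This bounds the initial value `u 0 = (μ x)⁻¹`.
        have h1 : (μ x)⁻¹ ≤ R ^ κ := by
          have := hvol.lower R hRR₀.le x x.2
          rw [Real.rpow_neg hR0.le] at this
          exact inv_le_of_inv_le₀ (by positivity) this
        gcongr
      · rw [← Real.mul_rpow (by positivity) (by positivity)]
        congr 1
        ring
    have h2 := hgen.exp_offDiag_le ((t : ℝ) / 2) ⟨x₁, hx₁⟩ ⟨x₂, hx₂⟩ (hdiag _) (hdiag _)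
    rw [add_halves] at h2
    exact h2
  refine ⟨hmain, fun Ω _ M hM => le_trans ?_ hmain⟩
  exact hM.killedHeatKernel_le hw hvol.pos (Conductance.ball_finite G hconn hfin o R)
    (by exact_mod_cast ht0) hx₁ hx₂
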